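/- Let $A=\mathcal{A}(1)_*/\tau$ be the quotient by $\tau$ of the $\mathbb{C}$-motivic Hopf algebra $\mathcal{A}(1)_*$, that is, the Hopf algebra over $\mathbb{F}_2$ $$A=\frac{\mathbb{F}_2[\tau_0,\tau_1,\xi_1]}{(\tau_0^2,\ \xi_1^2,\ \tau_1^2)}$$ with coproduct $\Delta(\tau_0)=\tau_0\otimes 1+1\otimes\tau_0$, $\Delta(\xi_1)=\xi_1\otimes 1+1\otimes\xi_1$, $\Delta(\tau_1)=\tau_1\otimes 1+\xi_1\otimes\tau_0+1\otimes\tau_1$, with counit vanishing on $\tau_0,\tau_1,\xi_1$, and with the bigrading (topological degree, motivic weight) $|\tau_0|=(1,0)$, $|\tau_1|=(3,1)$, $|\xi_1|=(2,1)$. Let $\mathrm{Ext}_A=\mathrm{Ext}_A(\mathbb{F}_2,\mathbb{F}_2)$ be its cohomology, i.e. the cohomology of the (reduced) cobar complex of $A$, with the ring structure given by concatenation. It is trigraded by (stem, filtration, weight): $\mathrm{Ext}_A^{s,f,w}$ consists of the classes of cocycles in $\overline{A}^{\otimes f}$ of topological degree $s+f$ and weight $w$, where $\overline{A}$ is the augmentation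 ideal. **Proposition 3.2.** There is an isomorphism of trigraded $\mathbb{F}_2$-algebras $$\mathrm{Ext}_{\mathcal{A}(1)_*/\tau}\;\cong\;\frac{\mathbb{F}_2[h_0,h_1,\overline{h_1^3}]}{(h_0h_1)},$$ where the generators $h_0$, $h_1$, $\overline{h_1^3}$ have degrees $$|h_0|=(0,1,0),\qquad |h_1|=(1,1,1),\qquad |\overline{h_1^3}|=(4,2,2).$$ -/

import Mathlib

open scoped TensorProduct

noncomputable section

/-! ### The cobar complex of a bialgebra over `𝔽₂`

The reduced cobar complex of `A` is `⨁_f Ā^{⊗ f}`, with `Ā = ker ε` the augmentation ideal. With the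
concatenation product this is the tensor algebra `T(Ā)`, and the cobar differential is
`d[a₁|…|a_f] = ∑ᵢ [a₁|…|Δ̄(aᵢ)|…|a_f]` (there are no signs in characteristic two), i.e. the unique
derivation of `T(Ā)` which restricts to the reduced coproduct `Δ̄` on `Ā`. -/

namespace Cobar

section General

variable (A : Type) [CommRing A] [Bialgebra (ZMod 2) A]

/-- The augmentation ideal `Ā = ker ε`, as a vector space. -/
abbrev Aug : Submodule (ZMod 2) A := LinearMap.ker (Coalgebra.counit (R := ZMod 2) (A := A))

/-- The projection `A → Ā`, `a ↦ a - ε(a) 1`. -/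
def proj : A →ₗ[ZMod 2] Aug A :=
  LinearMap.codRestrict (Aug A)
    (LinearMap.id - Algebra.linearMap (ZMod 2) A ∘ₗ Coalgebra.counit) (by
      intro a
      simp [Algebra.algebraMap_eq_smul_one])

/-- The reduced coproduct `Δ̄ : Ā → Ā ⊗ Ā`, `Δ̄(a) = Δ(a) - a ⊗ 1 - 1 ⊗ a`. -/
def redComul : Aug A →ₗ[ZMod 2] Aug A ⊗[ZMod 2] Aug A :=
  TensorProduct.map (proj A) (proj A) ∘ₗ Coalgebra.comul ∘ₗ (Aug A).subtype

/-- The cobar complex, as an algebra under concatenation; the bar word `[a₁|…|a_f]` is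
`TensorAlgebra.tprod (ZMod 2) (Aug A) f ![a₁, …, a_f]`. -/
abbrev Complex : Type := TensorAlgebra (ZMod 2) (Aug A)

/-- The inclusion `Ā ⊗ Ā → T(Ā)`, `a ⊗ b ↦ [a|b]`. -/
def incl₂ : Aug A ⊗[ZMod 2] Aug A →ₗ[ZMod 2] Complex A :=
  LinearMap.mul' (ZMod 2) (Complex A) ∘ₗ
    TensorProduct.map (TensorAlgebra.ι (ZMod 2)) (TensorAlgebra.ι (ZMod 2))

/-- The linear map `a ↦ ([a], Δ̄(a))` from `Ā` to the square-zero extension of `T(Ā)` by itself. -/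
def dLin : Aug A →ₗ[ZMod 2] TrivSqZeroExt (Complex A) (Complex A) where
  toFun a := TrivSqZeroExt.inl (TensorAlgebra.ι (ZMod 2) a) +
    TrivSqZeroExt.inr (incl₂ A (redComul A a))
  map_add' a b := by ext <;> simp
  map_smul' c a := by ext <;> simp

/-- The algebra map `x ↦ (x, d x)` extending `dLin`; its multiplicativity is the Leibniz rule. -/
def dHom : Complex A →ₐ[ZMod 2] TrivSqZeroExt (Complex A) (Complex A) :=
  TensorAlgebra.lift (ZMod 2) (dLin A)

/-- The cobar differential. -/
def d : Complex A →ₗ[ZMod 2] Complex A where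
  toFun x := (dHom A x).snd
  map_add' x y := by simp
  map_smul' c x := by simp

lemma dHom_fst (x : Complex A) : (dHom A x).fst = x := by
  have h : (TrivSqZeroExt.fstHom (ZMod 2) (Complex A) (Complex A)).comp (dHom A) =
      AlgHom.id _ _ := by
    apply TensorAlgebra.hom_ext
    ext a
    simp [dHom, dLin]
  exact DFunLike.congr_fun h x

lemma d_ι (a : Aug A) : d A (TensorAlgebra.ι (ZMod 2) a) = incl₂ A (redComul A a) := by
  simp [d, dHom, dLin]

lemma d_one : d A 1 = 0 := by
  simp [d]

lemma d_algebraMap (c : ZMod 2) : d A (algebraMap (ZMod 2) (Complex A) c) = 0 := by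
  rw [Algebra.algebraMap_eq_smul_one, map_smul, d_one, smul_zero]

lemma d_mul (x y : Complex A) : d A (x * y) = d A x * y + x * d A y := by
  simp [d, dHom_fst, add_comm]

lemma add_self (x : Complex A) : x + x = 0 := by
  rw [← two_smul (ZMod 2) x, show (2 : ZMod 2) = 0 from rfl, zero_smul]

lemma d_incl₂ (b c : Aug A) : d A (incl₂ A (b ⊗ₜ c)) =
    incl₂ A (redComul A b) * TensorAlgebra.ι (ZMod 2) c +
      TensorAlgebra.ι (ZMod 2) b * incl₂ A (redComul A c) := by
  rw [← d_ι, ← d_ι, ← d_mul]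
  simp [incl₂]

lemma proj_coe (a : A) :
    (proj A a : A) = a - algebraMap (ZMod 2) A (Coalgebra.counit a) := rfl

lemma proj_algebraMap (c : ZMod 2) : proj A (algebraMap (ZMod 2) A c) = 0 := by
  apply Subtype.ext
  simp [proj_coe]

lemma redComul_proj (a : A) : redComul A (proj A a) =
    TensorProduct.map (proj A) (proj A) (Coalgebra.comul a) := by
  have h : Coalgebra.comul (R := ZMod 2) (algebraMap (ZMod 2) A (Coalgebra.counit a)) =
      (algebraMap (ZMod 2) A (Coalgebra.counit a)) ⊗ₜ[ZMod 2] (1 : A) := by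
    rw [Bialgebra.comul_algebraMap]; rfl
  simp only [redComul, LinearMap.comp_apply, Submodule.subtype_apply, proj_coe, map_sub, h,
    TensorProduct.map_tmul, proj_algebraMap, TensorProduct.zero_tmul, sub_zero]

/-- The cobar differential squares to zero. -/
theorem d_d (x : Complex A) : d A (d A x) = 0 := by
  induction x using TensorAlgebra.induction with
  | algebraMap c => simp [d_algebraMap]
  | add x y hx hy => simp [hx, hy]
  | mul x y hx hy =>
    simp only [d_mul, map_add, hx, hy, zero_mul, mul_zero, zero_add, add_zero]
    exact add_self A _
  | ι a =>
    set j : A →ₗ[ZMod 2] Complex A := TensorAlgebra.ι (ZMod 2) ∘ₗ proj A with hj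
    set m : A ⊗[ZMod 2] A →ₗ[ZMod 2] Complex A :=
      incl₂ A ∘ₗ TensorProduct.map (proj A) (proj A) with hm
    have hd : ∀ u : A ⊗[ZMod 2] A, d A (m u) =
        LinearMap.mul' (ZMod 2) (Complex A)
          (TensorProduct.map m j (Coalgebra.comul.rTensor A u)) +
        LinearMap.mul' (ZMod 2) (Complex A)
          (TensorProduct.map j m (Coalgebra.comul.lTensor A u)) := by
      intro u
      induction u using TensorProduct.induction_on with
      | zero => simp
      | add u v hu hv => simp only [map_add, hu, hv]; abel
      | tmul b c =>
        simp [hm, hj, d_incl₂, redComul_proj]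
    have hassoc : ∀ u : (A ⊗[ZMod 2] A) ⊗[ZMod 2] A,
        LinearMap.mul' (ZMod 2) (Complex A) (TensorProduct.map j m
          (TensorProduct.assoc (ZMod 2) A A A u)) =
        LinearMap.mul' (ZMod 2) (Complex A) (TensorProduct.map m j u) := by
      intro u
      have : LinearMap.mul' (ZMod 2) (Complex A) ∘ₗ TensorProduct.map j m ∘ₗ
          (TensorProduct.assoc (ZMod 2) A A A).toLinearMap =
          LinearMap.mul' (ZMod 2) (Complex A) ∘ₗ TensorProduct.map m j := by
        ext a b c
        simp [hm, hj, incl₂, mul_assoc]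
      exact DFunLike.congr_fun this u
    have ha : redComul A a =
        TensorProduct.map (proj A) (proj A) (Coalgebra.comul (a : A)) := rfl
    rw [d_ι, ha]
    change d A (m (Coalgebra.comul (a : A))) = 0
    rw [hd, ← Coalgebra.coassoc_apply, hassoc]
    exact add_self A _

/-- The algebra of cocycles. -/
def cocycles : Subalgebra (ZMod 2) (Complex A) where
  carrier := {x | d A x = 0}
  mul_mem' {x y} hx hy := by
    have hx' : d A x = 0 := hx
    have hy' : d A y = 0 := hy
    simp [d_mul, hx', hy']
  add_mem' {x y} hx hy := by
    have hx' : d A x = 0 := hx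
    have hy' : d A y = 0 := hy
    simp [hx', hy']
  algebraMap_mem' c := d_algebraMap A c

/-- Two cocycles are cohomologous when they differ by a coboundary; this is compatible with the
ring operations. -/
def cohomologous : RingCon (cocycles A) where
  r x y := ∃ z, (x : Complex A) = y + d A z
  iseqv :=
    { refl := fun x => ⟨0, by simp⟩
      symm := by
        rintro x y ⟨z, hz⟩
        exact ⟨z, by rw [hz, add_assoc, add_self, add_zero]⟩
      trans := by
        rintro x y w ⟨z, hz⟩ ⟨z', hz'⟩
        exact ⟨z + z', by rw [hz, hz', map_add]; abel⟩ }
  add' := by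
    rintro x y x' y' ⟨z, hz⟩ ⟨z', hz'⟩
    exact ⟨z + z', by simp [hz, hz']; abel⟩
  mul' := by
    rintro x y x' y' ⟨z, hz⟩ ⟨z', hz'⟩
    refine ⟨z * x' + y * z', ?_⟩
    have hx' : d A (x' : Complex A) = 0 := x'.2
    have hy : d A (y : Complex A) = 0 := y.2
    have h : (y : Complex A) * d A z' = y * x' + y * y' := by
      rw [hz', mul_add, add_right_comm, add_self, zero_add]
    simp only [map_add, d_mul, hx', hy, mul_zero, add_zero, zero_mul, zero_add, h, hz,
      Subalgebra.coe_mul, add_mul]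
    rw [show ∀ p q r : Complex A, p + (q + (r + p)) = (p + p) + (r + q) by intros; abel,
      add_self, zero_add]

/-- `Ext_A(𝔽₂, 𝔽₂)`: the cohomology of the cobar complex, as an algebra under concatenation. -/
abbrev Ext : Type := (cohomologous A).Quotient

/-- The part of the cobar complex of filtration `f` and internal degree `e`, spanned by the words
`[a₁|…|a_f]` with `a₁, …, a_f` homogeneous of internal degrees adding up to `e`; here
`𝒜 e ⊆ A` is the part of internal degree `e = (topological degree, motivic weight)`. -/
def complexGrade (𝒜 : ℤ × ℤ → Submodule (ZMod 2) A) (f : ℕ) (e : ℤ × ℤ) :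
    Submodule (ZMod 2) (Complex A) :=
  Submodule.span (ZMod 2) {x | ∃ (δ : Fin f → ℤ × ℤ) (a : Fin f → Aug A),
    (∀ i, (a i : A) ∈ 𝒜 (δ i)) ∧ ∑ i, δ i = e ∧ x = TensorAlgebra.tprod (ZMod 2) (Aug A) f a}

/-- `Ext^{s,f,w}`: the classes of the cocycles of filtration `f`, topological degree `t = s + f`
(so that `s = t - f` is the stem) and motivic weight `w`. -/
def extGrade (𝒜 : ℤ × ℤ → Submodule (ZMod 2) A) (n : ℤ × ℕ × ℤ) : Submodule (ZMod 2) (Ext A) :=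
  ((complexGrade A 𝒜 n.2.1 (n.1 + n.2.1, n.2.2)).comap (cocycles A).val.toLinearMap).map
    ((cohomologous A).mkₐ (α := ZMod 2)).toLinearMap

end General

end Cobar

/-! ### The Hopf algebra `A(1)_*/τ` -/

namespace A1ModTau

/-- The relations `τ₀² = ξ₁² = τ₁² = 0`, where `X 0 = τ₀`, `X 1 = τ₁` and `X 2 = ξ₁`. -/
def relations : Ideal (MvPolynomial (Fin 3) (ZMod 2)) :=
  Ideal.span {MvPolynomial.X 0 ^ 2, MvPolynomial.X 2 ^ 2, MvPolynomial.X 1 ^ 2}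

end A1ModTau

/-- `A(1)_*/τ = 𝔽₂[τ₀, τ₁, ξ₁] / (τ₀², ξ₁², τ₁²)`. -/
def A1ModTau : Type := MvPolynomial (Fin 3) (ZMod 2) ⧸ A1ModTau.relations

namespace A1ModTau

instance : CommRing A1ModTau :=
  inferInstanceAs (CommRing (MvPolynomial (Fin 3) (ZMod 2) ⧸ A1ModTau.relations))

instance : Algebra (ZMod 2) A1ModTau :=
  inferInstanceAs (Algebra (ZMod 2) (MvPolynomial (Fin 3) (ZMod 2) ⧸ A1ModTau.relations))

/-- The quotient map `𝔽₂[τ₀, τ₁, ξ₁] → A(1)_*/τ`. -/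
def mk : MvPolynomial (Fin 3) (ZMod 2) →ₐ[ZMod 2] A1ModTau :=
  Ideal.Quotient.mkₐ (ZMod 2) relations

def τ₀ : A1ModTau := mk (MvPolynomial.X 0)

def τ₁ : A1ModTau := mk (MvPolynomial.X 1)

def ξ₁ : A1ModTau := mk (MvPolynomial.X 2)

lemma τ₀_sq : τ₀ ^ 2 = 0 := by
  rw [τ₀, ← map_pow]
  exact Ideal.Quotient.eq_zero_iff_mem.2 (Ideal.subset_span (by simp))

lemma τ₁_sq : τ₁ ^ 2 = 0 := by
  rw [τ₁, ← map_pow]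
  exact Ideal.Quotient.eq_zero_iff_mem.2 (Ideal.subset_span (by simp))

lemma ξ₁_sq : ξ₁ ^ 2 = 0 := by
  rw [ξ₁, ← map_pow]
  exact Ideal.Quotient.eq_zero_iff_mem.2 (Ideal.subset_span (by simp))

/-- An algebra map out of `A(1)_*/τ` is given by the images of `τ₀`, `τ₁`, `ξ₁`. -/
def lift {B : Type} [CommRing B] [Algebra (ZMod 2) B] (b : Fin 3 → B) (hb : ∀ i, b i ^ 2 = 0) :
    A1ModTau →ₐ[ZMod 2] B :=
  Ideal.Quotient.liftₐ relations (MvPolynomial.aeval b) (by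
    intro x hx
    have h : relations ≤ RingHom.ker (MvPolynomial.aeval b : _ →ₐ[ZMod 2] B) := by
      refine Ideal.span_le.2 ?_
      rintro y (rfl | rfl | rfl) <;> simp [hb, RingHom.mem_ker]
    exact h hx)

@[simp] lemma lift_τ₀ {B : Type} [CommRing B] [Algebra (ZMod 2) B] (b : Fin 3 → B)
    (hb : ∀ i, b i ^ 2 = 0) : lift b hb τ₀ = b 0 :=
  MvPolynomial.aeval_X b 0

@[simp] lemma lift_τ₁ {B : Type} [CommRing B] [Algebra (ZMod 2) B] (b : Fin 3 → B)
    (hb : ∀ i, b i ^ 2 = 0) : lift b hb τ₁ = b 1 :=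
  MvPolynomial.aeval_X b 1

@[simp] lemma lift_ξ₁ {B : Type} [CommRing B] [Algebra (ZMod 2) B] (b : Fin 3 → B)
    (hb : ∀ i, b i ^ 2 = 0) : lift b hb ξ₁ = b 2 :=
  MvPolynomial.aeval_X b 2

lemma hom_ext {B : Type} [Semiring B] [Algebra (ZMod 2) B] {φ ψ : A1ModTau →ₐ[ZMod 2] B}
    (h₀ : φ τ₀ = ψ τ₀) (h₁ : φ τ₁ = ψ τ₁) (h₂ : φ ξ₁ = ψ ξ₁) : φ = ψ := by
  apply Ideal.Quotient.algHom_ext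
  apply MvPolynomial.algHom_ext
  intro i
  fin_cases i
  exacts [h₀, h₁, h₂]

lemma add_sq_of_algebra {B : Type} [CommRing B] [Algebra (ZMod 2) B] (x y : B) :
    (x + y) ^ 2 = x ^ 2 + y ^ 2 := by
  have h : (2 : B) = 0 := by
    rw [← map_ofNat (algebraMap (ZMod 2) B) 2, ← map_zero (algebraMap (ZMod 2) B)]
    exact congrArg (algebraMap (ZMod 2) B) rfl
  rw [add_sq, h, zero_mul, zero_mul, add_zero]

/-- The coproduct: `τ₀ ↦ τ₀ ⊗ 1 + 1 ⊗ τ₀`, `τ₁ ↦ τ₁ ⊗ 1 + ξ₁ ⊗ τ₀ + 1 ⊗ τ₁`,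
`ξ₁ ↦ ξ₁ ⊗ 1 + 1 ⊗ ξ₁`. -/
def comulHom : A1ModTau →ₐ[ZMod 2] A1ModTau ⊗[ZMod 2] A1ModTau :=
  lift ![τ₀ ⊗ₜ[ZMod 2] 1 + 1 ⊗ₜ[ZMod 2] τ₀,
    τ₁ ⊗ₜ[ZMod 2] 1 + ξ₁ ⊗ₜ[ZMod 2] τ₀ + 1 ⊗ₜ[ZMod 2] τ₁, ξ₁ ⊗ₜ[ZMod 2] 1 + 1 ⊗ₜ[ZMod 2] ξ₁] (by
    intro i
    fin_cases i <;>
      simp [add_sq_of_algebra, Algebra.TensorProduct.tmul_pow, τ₀_sq, τ₁_sq, ξ₁_sq])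

/-- The counit, which vanishes on `τ₀`, `τ₁`, `ξ₁`. -/
def counitHom : A1ModTau →ₐ[ZMod 2] ZMod 2 :=
  lift 0 (by simp)

instance : Bialgebra (ZMod 2) A1ModTau :=
  Bialgebra.ofAlgHom comulHom counitHom
    (by
      apply hom_ext <;>
        simp [comulHom, TensorProduct.add_tmul, TensorProduct.tmul_add,
          Algebra.TensorProduct.one_def] <;> abel)
    (by
      apply hom_ext <;> simp [comulHom, counitHom])
    (by
      apply hom_ext <;> simp [comulHom, counitHom])

/-- The part of `A(1)_*/τ` of given (topological degree, motivic weight), where `|τ₀| = (1, 0)`,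
`|τ₁| = (3, 1)`, `|ξ₁| = (2, 1)`. -/
def grade (e : ℤ × ℤ) : Submodule (ZMod 2) A1ModTau :=
  (MvPolynomial.weightedHomogeneousSubmodule (ZMod 2)
    (![(1, 0), (3, 1), (2, 1)] : Fin 3 → ℤ × ℤ) e).map
      mk.toLinearMap

end A1ModTau

/-- The ring `𝔽₂[h₀, h₁, b] / (h₀ h₁)`, with `X 0 = h₀`, `X 1 = h₁` and `X 2 = b`. -/
abbrev ExtRing : Type :=
  MvPolynomial (Fin 3) (ZMod 2) ⧸
    Ideal.span {(MvPolynomial.X 0 * MvPolynomial.X 1 : MvPolynomial (Fin 3) (ZMod 2))}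

/-- The trigrading by (stem, filtration, motivic weight) with `|h₀| = (0, 1, 0)`,
`|h₁| = (1, 1, 1)`, `|b| = (4, 2, 2)`. -/
def ExtRing.grade (n : ℤ × ℕ × ℤ) : Submodule (ZMod 2) ExtRing :=
  (MvPolynomial.weightedHomogeneousSubmodule (ZMod 2)
    (![(0, 1, 0), (1, 1, 1), (4, 2, 2)] : Fin 3 → ℤ × ℕ × ℤ) n).map
      (Ideal.Quotient.mkₐ (ZMod 2)
        (Ideal.span {(MvPolynomial.X 0 * MvPolynomial.X 1 :
          MvPolynomial (Fin 3) (ZMod 2))})).toLinearMap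

end

/-!
# The cohomology of `A(1)_*/τ`

The dual algebra of `A = A(1)_*/τ` is a nonhomogeneous Koszul algebra of Poincaré–Birkhoff–Witt type
on three exterior generators dual to `τ₀`, `ξ₁`, `τ₁`, with the single nontrivial commutator
`[P, Q₀] = Q₁`. Its Koszul dual is the commutative differential graded algebra
`S = 𝔽₂[h₀, h₁, v]` with `d v = h₀ h₁`. In characteristic two the cycles of `S` are
`𝔽₂[h₀, h₁, v²]` and the boundaries are the multiples of `h₀ h₁` among them, so that
`H(S) = 𝔽₂[h₀, h₁, v²] / (h₀ h₁)`, which is the ring to be found.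

The comparison map `toModel : T(Ā) → S`, which sends `[τ₀]`, `[ξ₁]`, `[τ₁]` to `h₀`, `h₁`, `v` and the
other basis monomials of `Ā` to zero, is a map of differential graded algebras (`toModel_d`). It is
onto on cohomology, because `h₀`, `h₁` and `v²` lift to the cocycles `[τ₀]`, `[ξ₁]` and
`[τ₁|τ₁] + [ξ₁|τ₀τ₁] + [ξ₁τ₁|τ₀]`. It is injective on cohomology (`exists_d_eq`): splitting off the
last letter identifies the cobar complex in positive degrees with the twisted tensor product
`T(Ā) ⊗ Ā` (`contractRight_d`), and `S` with `S ⊗ Ā` up to cohomology, the latter because the twisted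
Koszul complex `S ⊗ A` is acyclic (`koszul_exact`). Both twisted products are filtered by a basis of
`Ā` along which the reduced coproduct is triangular, so injectivity in degree `n + 1` follows from
bijectivity in degree `n` by removing the letters one at a time (`exists_primitive_step`).

In particular no homotopies for the commutativity of `Ext` are needed: `Ext` embeds into the
commutative ring `S / (h₀ h₁)`, with the same image as `𝔽₂[h₀, h₁, b] / (h₀ h₁)` under `b ↦ v²`.
-/

noncomputable section

/-! ### Right contraction in a tensor algebra -/

namespace TensorAlgebra

variable {R M : Type*} [CommRing R] [AddCommGroup M] [Module R M]

/-- The algebra map underlying `contractRight`: it sends `x` to the upper triangular matrix with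
diagonal `(x, ε(x))`, so that its upper right entry obeys the product rule of a right
contraction. -/
def contractRightHom (f : M →ₗ[R] R) :
    TensorAlgebra R M →ₐ[R] Matrix (Fin 2) (Fin 2) (TensorAlgebra R M) :=
  lift R
    { toFun := fun m => !![ι R m, algebraMap R _ (f m); 0, 0]
      map_add' := fun m n => by ext i j; fin_cases i <;> fin_cases j <;> simp
      map_smul' := fun c m => by
        ext i j; fin_cases i <;> fin_cases j <;> simp [Algebra.smul_def] }

lemma contractRightHom_apply (f : M →ₗ[R] R) (x : TensorAlgebra R M) :
    contractRightHom f x 0 0 = x ∧ contractRightHom f x 1 0 = 0 ∧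
      contractRightHom f x 1 1 = algebraMap R _ (algebraMapInv x) := by
  induction x using TensorAlgebra.induction with
  | algebraMap c => simp [Matrix.algebraMap_matrix_apply, algebraMapInv]
  | ι m => simp [contractRightHom, algebraMapInv]
  | add x y hx hy => simp [hx, hy]
  | mul x y hx hy => simp [Matrix.mul_apply, hx, hy]

/-- Contraction of the last letter of a word with a linear functional `f`:
`[m₁|…|m_n] ↦ f(m_n) [m₁|…|m_{n-1}]`, and `1 ↦ 0`. -/
def contractRight (f : M →ₗ[R] R) : TensorAlgebra R M →ₗ[R] TensorAlgebra R M where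
  toFun x := contractRightHom f x 0 1
  map_add' x y := by simp
  map_smul' c x := by simp

lemma contractRight_mul (f : M →ₗ[R] R) (x y : TensorAlgebra R M) :
    contractRight f (x * y) = x * contractRight f y + algebraMapInv y • contractRight f x := by
  simp [contractRight, Matrix.mul_apply, contractRightHom_apply, Algebra.smul_def,
    Algebra.commutes]

@[simp] lemma contractRight_ι (f : M →ₗ[R] R) (m : M) :
    contractRight f (ι R m) = algebraMap R _ (f m) := by
  simp [contractRight, contractRightHom]

@[simp] lemma contractRight_algebraMap (f : M →ₗ[R] R) (c : R) :
    contractRight f (algebraMap R _ c) = 0 := by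
  simp [contractRight, Matrix.algebraMap_matrix_apply]

@[simp] lemma algebraMapInv_ι (m : M) : algebraMapInv (ι R m) = 0 := by
  simp [algebraMapInv]

@[simp] lemma algebraMapInv_algebraMap (c : R) :
    algebraMapInv (algebraMap R (TensorAlgebra R M) c) = c :=
  algebraMap_leftInverse M c

lemma contractRight_mul_ι (f : M →ₗ[R] R) (x : TensorAlgebra R M) (m : M) :
    contractRight f (x * ι R m) = f m • x := by
  simp [contractRight_mul, Algebra.smul_def, Algebra.commutes]

/-- Every element of a tensor algebra is recovered from its constant term and its contractions
with the coordinates of a basis. -/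
lemma eq_add_sum_contractRight {I : Type*} [Fintype I] (b : Module.Basis I R M)
    (x : TensorAlgebra R M) :
    x = algebraMap R _ (algebraMapInv x) + ∑ i, contractRight (b.coord i) x * ι R (b i) := by
  induction x using TensorAlgebra.induction with
  | algebraMap c => simp
  | ι m =>
    simp only [algebraMapInv_ι, map_zero, zero_add, contractRight_ι, ← Algebra.smul_def,
      Module.Basis.coord_apply, ← map_smul, ← map_sum, b.sum_repr]
  | add x y hx hy =>
    simp only [map_add, add_mul, Finset.sum_add_distrib]
    conv_lhs => rw [hx, hy]
    abel
  | mul x y hx hy =>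
    simp only [contractRight_mul, add_mul, Finset.sum_add_distrib, smul_mul_assoc, mul_assoc,
      ← Finset.mul_sum, ← Finset.smul_sum, map_mul]
    conv_lhs => rw [hy, mul_add, ← Algebra.commutes]
    nth_rw 1 [hx]
    rw [Algebra.smul_def, mul_add,
      Algebra.commutes (algebraMapInv y) (algebraMap R _ (algebraMapInv x))]
    abel

/-- The homogeneous elements of degree `n`, i.e. the span of the words of length `n`. -/
abbrev homogeneous (R M : Type*) [CommRing R] [AddCommGroup M] [Module R M] (n : ℕ) :
    Submodule R (TensorAlgebra R M) :=
  LinearMap.range (ι R : M →ₗ[R] TensorAlgebra R M) ^ n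

lemma mul_ι_mem_homogeneous {n : ℕ} {x : TensorAlgebra R M} (hx : x ∈ homogeneous R M n) (m : M) :
    x * ι R m ∈ homogeneous R M (n + 1) := by
  rw [homogeneous, pow_succ]
  exact Submodule.mul_mem_mul hx ⟨m, rfl⟩

/-- Induction on homogeneous elements, splitting off the last letter. -/
lemma homogeneous_induction {C : ∀ n x, x ∈ homogeneous R M n → Prop}
    (algebraMap : ∀ c, C 0 (algebraMap R _ c) (by simp [Submodule.mem_one]))
    (mul_ι : ∀ n x hx m, C n x hx → C (n + 1) (x * ι R m) (mul_ι_mem_homogeneous hx m))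
    (add : ∀ n x y hx hy, C n x hx → C n y hy → C n (x + y) (add_mem hx hy))
    {n : ℕ} {x : TensorAlgebra R M} (hx : x ∈ homogeneous R M n) : C n x hx := by
  induction hx using Submodule.pow_induction_on_right' with
  | algebraMap r => exact algebraMap r
  | add x y i hx hy ihx ihy => exact add i x y hx hy ihx ihy
  | mul_mem i x hx ih m hm =>
    obtain ⟨m, rfl⟩ := hm
    exact mul_ι i x hx m ih

lemma contractRight_mem_homogeneous (f : M →ₗ[R] R) {n : ℕ} {x : TensorAlgebra R M}
    (hx : x ∈ homogeneous R M (n + 1)) : contractRight f x ∈ homogeneous R M n := by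
  rw [homogeneous, pow_succ] at hx
  induction hx using Submodule.mul_induction_on' with
  | mem_mul_mem x hx m hm =>
    obtain ⟨m, rfl⟩ := hm
    rw [contractRight_mul_ι]
    exact Submodule.smul_mem _ _ hx
  | add x _ y _ hx hy => rw [map_add]; exact add_mem hx hy

lemma algebraMapInv_eq_zero {n : ℕ} {x : TensorAlgebra R M}
    (hx : x ∈ homogeneous R M (n + 1)) : algebraMapInv x = 0 := by
  rw [homogeneous, pow_succ] at hx
  induction hx using Submodule.mul_induction_on' with
  | mem_mul_mem x hx m hm =>
    obtain ⟨m, rfl⟩ := hm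
    simp
  | add x _ y _ hx hy => rw [map_add, hx, hy, add_zero]

end TensorAlgebra

/-! ### Homogeneous linear maps commute with projections -/

/-- A linear map which maps degree `n` to degree `g n`, for an injective `g`, commutes with the
projections to homogeneous components. -/
lemma DirectSum.decompose_map_apply {R M N : Type*} [CommRing R] [AddCommGroup M] [Module R M]
    [AddCommGroup N] [Module R N] {ι κ : Type*} [DecidableEq ι] [DecidableEq κ]
    (ℳ : ι → Submodule R M) (𝒩 : κ → Submodule R N) [DirectSum.Decomposition ℳ]
    [DirectSum.Decomposition 𝒩] (L : M →ₗ[R] N) {g : ι → κ} (hg : Function.Injective g)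
    (hL : ∀ n, ∀ x ∈ ℳ n, L x ∈ 𝒩 (g n)) (n : ι) (x : M) :
    (DirectSum.decompose 𝒩 (L x) (g n) : N) = L (DirectSum.decompose ℳ x n) := by
  induction x using DirectSum.Decomposition.inductionOn ℳ with
  | zero => simp
  | @homogeneous i x =>
    by_cases h : i = n
    · subst h
      rw [DirectSum.decompose_of_mem_same _ (hL _ _ x.2),
        DirectSum.decompose_of_mem_same _ x.2]
    · rw [DirectSum.decompose_of_mem_ne _ (hL _ _ x.2) (hg.ne h),
        DirectSum.decompose_of_mem_ne _ x.2 h, map_zero]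
  | add x y hx hy => simp [hx, hy]

attribute [local instance] MvPolynomial.weightedDecomposition in
/-- The analogue of `DirectSum.decompose_map_apply` for a linear map into a polynomial ring. -/
lemma MvPolynomial.weightedHomogeneousComponent_map {R M : Type*} [CommRing R] [AddCommGroup M]
    [Module R M] {ι : Type*} [DecidableEq ι] (ℳ : ι → Submodule R M) [DirectSum.Decomposition ℳ]
    {σ κ : Type*} [AddCommMonoid κ] [DecidableEq κ] (w : σ → κ)
    (L : M →ₗ[R] MvPolynomial σ R) {g : ι → κ} (hg : Function.Injective g)
    (hL : ∀ n, ∀ x ∈ ℳ n, (L x).IsWeightedHomogeneous w (g n)) (n : ι) (x : M) :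
    MvPolynomial.weightedHomogeneousComponent w (g n) (L x) =
      L (DirectSum.decompose ℳ x n) := by
  rw [← DirectSum.decompose_map_apply ℳ (MvPolynomial.weightedHomogeneousSubmodule R w) L hg hL]
  exact (MvPolynomial.weightedDecomposition.decompose'_apply R w (L x) (g n)).symm

attribute [local instance] MvPolynomial.weightedDecomposition in
/-- The analogue of `DirectSum.decompose_map_apply` for polynomial rings. -/
lemma MvPolynomial.weightedHomogeneousComponent_map' {R σ σ' κ κ' : Type*} [CommRing R]
    [AddCommMonoid κ] [AddCommMonoid κ'] [DecidableEq κ] [DecidableEq κ'] (w : σ → κ)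
    (w' : σ' → κ') (L : MvPolynomial σ R →ₗ[R] MvPolynomial σ' R) {g : κ → κ'}
    (hg : Function.Injective g)
    (hL : ∀ n p, p.IsWeightedHomogeneous w n → (L p).IsWeightedHomogeneous w' (g n))
    (n : κ) (p : MvPolynomial σ R) :
    MvPolynomial.weightedHomogeneousComponent w' (g n) (L p) =
      L (MvPolynomial.weightedHomogeneousComponent w n p) := by
  rw [MvPolynomial.weightedHomogeneousComponent_map
    (MvPolynomial.weightedHomogeneousSubmodule R w) w' L hg hL]
  exact congrArg L (MvPolynomial.weightedDecomposition.decompose'_apply R w p n)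

/-! ### The polynomial differential graded algebra `𝔽₂[h₀, h₁, v]` with `d v = h₀ h₁` -/

namespace PolyModel

open MvPolynomial

/-- The polynomial ring `𝔽₂[h₀, h₁, v]`, with `X 0 = h₀`, `X 1 = h₁` and `X 2 = v`. -/
abbrev Model : Type := MvPolynomial (Fin 3) (ZMod 2)

/-- The differential `d = h₀ h₁ ∂/∂v`. -/
def diff : Derivation (ZMod 2) Model Model := (X 0 * X 1 : Model) • pderiv 2

lemma diff_apply (p : Model) : diff p = X 0 * X 1 * pderiv 2 p := rfl

lemma diff_mul (p q : Model) : diff (p * q) = p * diff q + q * diff p := by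
  simp [diff.leibniz]

@[simp] lemma diff_X0 : diff (X 0) = 0 := by simp [diff_apply, pderiv_X]
@[simp] lemma diff_X1 : diff (X 1) = 0 := by simp [diff_apply, pderiv_X]
@[simp] lemma diff_X2 : diff (X 2) = X 0 * X 1 := by simp [diff_apply]
@[simp] lemma diff_C (c : ZMod 2) : diff (C c) = 0 := by simp

lemma diff_X0_mul (p : Model) : diff (X 0 * p) = X 0 * diff p := by simp
lemma diff_X1_mul (p : Model) : diff (X 1 * p) = X 1 * diff p := by simp
lemma diff_X2_mul (p : Model) : diff (X 2 * p) = X 2 * diff p + X 0 * X 1 * p := by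
  rw [diff_mul, diff_X2, mul_comm p]

lemma constantCoeff_diff (p : Model) : constantCoeff (diff p) = 0 := by
  simp [diff_apply]

lemma diff_diff (p : Model) : diff (diff p) = 0 := by
  induction p using MvPolynomial.induction_on with
  | C c => simp
  | add p q hp hq => simp [hp, hq]
  | mul_X p i hp =>
    have hi : diff (diff (X i)) = 0 := by
      fin_cases i <;> simp
    have h := CharTwo.add_self_eq_zero (diff (X i) * diff p)
    simp only [diff_mul, map_add, hp, hi]
    linear_combination h

/-- The algebra map `𝔽₂[h₀, h₁, b] → 𝔽₂[h₀, h₁, v]`, `b ↦ v²`. -/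
def sqMap : Model →ₐ[ZMod 2] Model := aeval ![X 0, X 1, X 2 ^ 2]

lemma coeff_eq_zero_of_odd {p : Model} (hp : diff p = 0) {m : Fin 3 →₀ ℕ} (hm : Odd (m 2)) :
    coeff m p = 0 := by
  have h : pderiv 2 p = 0 := by
    simpa [diff_apply] using hp
  obtain ⟨k, hk⟩ := hm
  have h2 := congrArg (coeff (m - Finsupp.single 2 1)) h
  have hle : Finsupp.single 2 1 ≤ m := by simp; omega
  rw [coeff_pderiv, tsub_add_cancel_of_le hle] at h2
  have h3 : ((m - Finsupp.single 2 1 : Fin 3 →₀ ℕ) 2 : ZMod 2) + 1 = 1 := by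
    have : (2 : ZMod 2) = 0 := rfl
    simp [hk, this]
  rwa [h3, mul_one, coeff_zero] at h2

/-- The cycles of `𝔽₂[h₀, h₁, v]` are the polynomials in `h₀`, `h₁` and `v²`. -/
lemma mem_range_sqMap {p : Model} (hp : diff p = 0) : p ∈ sqMap.range := by
  rw [p.as_sum]
  refine sum_mem fun m hm => ?_
  obtain ⟨k, hk⟩ : Even (m 2) := by
    by_contra h
    exact (mem_support_iff.1 hm) (coeff_eq_zero_of_odd hp (Nat.not_even_iff_odd.1 h))
  refine ⟨C (coeff m p) * X 0 ^ m 0 * X 1 ^ m 1 * X 2 ^ k, ?_⟩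
  rw [monomial_eq, Finsupp.prod_fintype _ _ (by simp)]
  simp [sqMap, Fin.prod_univ_three, hk, ← pow_mul, mul_assoc, two_mul]

lemma sqMap_injective : Function.Injective sqMap := by
  -- squaring `h₀` and `h₁` as well turns `sqMap` into the Frobenius
  have h : ∀ p : Model, aeval ![X 0 ^ 2, X 1 ^ 2, X 2] (sqMap p) = p ^ 2 := by
    intro p
    have : (aeval ![X 0 ^ 2, X 1 ^ 2, X 2] : Model →ₐ[ZMod 2] Model).comp sqMap = expand 2 := by
      ext i : 1
      fin_cases i <;> simp [sqMap]
    exact (DFunLike.congr_fun this p).trans (MvPolynomial.expand_zmod p)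
  rw [injective_iff_map_eq_zero]
  intro p hp
  have := h p
  rw [hp, map_zero] at this
  exact pow_eq_zero_iff two_ne_zero |>.1 this.symm

/-- Modulo an ideal containing all `X i - g i`, a polynomial agrees with its value at `g`. -/
lemma sub_aeval_mem (g : Fin 3 → Model) (I : Ideal Model) (h : ∀ i, X i - g i ∈ I) (p : Model) :
    p - aeval g p ∈ I := by
  have : (Ideal.Quotient.mkₐ (ZMod 2) I).comp (aeval g) = Ideal.Quotient.mkₐ (ZMod 2) I := by
    ext i : 1
    simpa [eq_comm] using Ideal.Quotient.eq.2 (h i)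
  exact Ideal.Quotient.eq.1 (DFunLike.congr_fun this p).symm

lemma X0_dvd {p : Model} (h : aeval ![0, X 1, X 2] p = (0 : Model)) : X 0 ∣ p := by
  have := sub_aeval_mem ![0, X 1, X 2] (Ideal.span {X 0})
    (by intro i; fin_cases i <;> simp) p
  rwa [h, sub_zero, Ideal.mem_span_singleton] at this

lemma X1_dvd {p : Model} (h : aeval ![X 0, 0, X 2] p = (0 : Model)) : X 1 ∣ p := by
  have := sub_aeval_mem ![X 0, 0, X 2] (Ideal.span {X 1})
    (by intro i; fin_cases i <;> simp) p
  rwa [h, sub_zero, Ideal.mem_span_singleton] at this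

/-- The substitution `b ↦ v²` is injective modulo `h₀ h₁`. -/
lemma dvd_of_dvd_sqMap {p : Model} (h : X 0 * X 1 ∣ sqMap p) : X 0 * X 1 ∣ p := by
  obtain ⟨q, hq⟩ := h
  have h0 : sqMap (aeval ![0, X 1, X 2] p) = aeval ![0, X 1, X 2] (sqMap p) := by
    have : sqMap.comp (aeval ![0, X 1, X 2]) = (aeval ![0, X 1, X 2]).comp sqMap := by
      ext i : 1
      fin_cases i <;> simp [sqMap]
    exact DFunLike.congr_fun this p
  -- both `h₀ = 0` and `h₁ = 0` are compatible with the substitution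
  obtain ⟨p, rfl⟩ := X0_dvd (sqMap_injective (by rw [h0, hq]; simp))
  have hq' : sqMap p = X 1 * q := by
    apply mul_left_cancel₀ (X_ne_zero (R := ZMod 2) (0 : Fin 3))
    rw [← mul_assoc, ← hq]
    simp [sqMap]
  have h1 : sqMap (aeval ![X 0, 0, X 2] p) = aeval ![X 0, 0, X 2] (sqMap p) := by
    have : sqMap.comp (aeval ![X 0, 0, X 2]) = (aeval ![X 0, 0, X 2]).comp sqMap := by
      ext i : 1
      fin_cases i <;> simp [sqMap]
    exact DFunLike.congr_fun this p
  exact mul_dvd_mul_left _ (X1_dvd (sqMap_injective (by rw [h1, hq']; simp)))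

/-- A cycle divisible by `h₀ h₁` is a boundary: `h₀ h₁ q = d (v q)` when `d q = 0`. -/
lemma exists_diff_of_dvd {p : Model} (hp : diff p = 0) (h : X 0 * X 1 ∣ p) :
    ∃ q, p = diff q := by
  obtain ⟨q, rfl⟩ := h
  rw [mul_assoc, diff_X0_mul, diff_X1_mul] at hp
  have hq : diff q = 0 := by simpa using hp
  exact ⟨X 2 * q, by rw [diff_X2_mul, hq]; ring⟩

/-! ### Exactness of the Koszul complex -/

lemma exists_eq_C_add (p : Model) :
    ∃ a b c, p = C (constantCoeff p) + X 0 * a + X 1 * b + X 2 * c := by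
  have h := sub_aeval_mem 0 (Ideal.span {X 0, X 1, X 2})
    (by intro i; fin_cases i <;> exact Ideal.subset_span (by simp)) p
  obtain ⟨a, q, hq, h⟩ := Ideal.mem_span_insert.1 h
  obtain ⟨b, c, rfl⟩ := Ideal.mem_span_pair.1 hq
  refine ⟨a, b, c, ?_⟩
  have h0 : aeval (0 : Fin 3 → Model) p = C (constantCoeff p) := by
    rw [aeval_zero]; rfl
  rw [h0] at h
  linear_combination h

lemma two_eq_zero : (2 : Model) = 0 := CharP.cast_eq_zero Model 2

/-- The syzygies of the regular sequence `h₀, h₁, v` are the Koszul relations. -/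
lemma exists_koszul {a b c : Model} (h : X 0 * a + X 1 * b + X 2 * c = 0) :
    ∃ p q r, a = X 1 * p + X 2 * q ∧ b = X 0 * p + X 2 * r ∧ c = X 0 * q + X 1 * r := by
  have hc := sub_aeval_mem ![0, 0, X 2] (Ideal.span {X 0, X 1})
    (by intro i; fin_cases i <;> simp <;> exact Ideal.subset_span (by simp)) c
  have hc0 : aeval ![0, 0, X 2] c = (0 : Model) := by
    simpa using congrArg (aeval ![(0 : Model), 0, X 2]) h
  rw [hc0, sub_zero] at hc
  obtain ⟨q, r, rfl⟩ := Ideal.mem_span_pair.1 hc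
  have hb : X 0 ∣ b + X 2 * r := by
    apply X0_dvd
    have := congrArg (aeval ![(0 : Model), X 1, X 2]) h
    simp only [map_add, map_mul, aeval_X, Matrix.cons_val, zero_mul, mul_zero, zero_add, map_zero]
      at this ⊢
    apply mul_left_cancel₀ (X_ne_zero (R := ZMod 2) (1 : Fin 3))
    linear_combination this
  obtain ⟨p, hp⟩ := hb
  refine ⟨p, q, r, ?_, ?_, by ring⟩
  · apply mul_left_cancel₀ (X_ne_zero (R := ZMod 2) (0 : Fin 3))
    linear_combination h - X 1 * hp - (X 0 * X 1 * p + X 0 * X 2 * q) * two_eq_zero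
  · linear_combination hp - X 2 * r * two_eq_zero

/-- Acyclicity of the twisted Koszul complex `𝔽₂[h₀, h₁, v] ⊗ A(1)_*/τ` in the components other than
`1`. Here `s, a, b, c, A, B, D, E` are the coefficients of `1, τ₀, ξ₁, τ₁, τ₀ξ₁, τ₀τ₁, ξ₁τ₁, τ₀ξ₁τ₁`.
The primitive is built from the bottom up by dividing by the regular sequence `h₀, h₁, v`: its
coefficients at `τ₀, ξ₁, τ₁` come from `s`, those at the products of two generators from the
Koszul syzygies, and the last one from the divisibility of `D` by `h₀`. -/
lemma koszul_exact {s a b c A B D E : Model}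
    (hD : diff D + X 0 * E = 0) (hc : diff c + X 0 * B + X 1 * D = 0)
    (hb : diff b + X 0 * A + X 2 * D = 0)
    (hs : diff s + X 0 * a + X 1 * b + X 2 * c = 0) :
    ∃ a' b' c' A' B' D' E', E = diff E' ∧ D = diff D' + X 0 * E' ∧ B = diff B' + X 1 * E' ∧
      A = diff A' + X 2 * E' + X 1 * D' ∧ c = diff c' + X 0 * B' + X 1 * D' ∧
      b = diff b' + X 0 * A' + X 2 * D' ∧ a = diff a' + X 1 * c' + X 1 * A' + X 2 * B' := by
  obtain ⟨a₁, b₁, c₁, hs₁⟩ := exists_eq_C_add s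
  have hs₂ := congrArg diff hs₁
  simp only [map_add, diff_C, diff_X0_mul, diff_X1_mul, diff_X2_mul] at hs₂
  obtain ⟨A₁, B₁, D₁, ha₁, hb₁, hc₁⟩ : ∃ p q r, a + diff a₁ + X 1 * c₁ = X 1 * p + X 2 * q ∧
      b + diff b₁ = X 0 * p + X 2 * r ∧ c + diff c₁ = X 0 * q + X 1 * r :=
    exists_koszul (by linear_combination hs - hs₂)
  have ha₂ := congrArg diff ha₁
  have hb₂ := congrArg diff hb₁
  have hc₂ := congrArg diff hc₁
  simp only [map_add, diff_X0_mul, diff_X1_mul, diff_X2_mul, diff_diff, add_zero]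
    at ha₂ hb₂ hc₂
  have e₁ : X 0 * (B + diff B₁) + X 1 * (D + diff D₁) = 0 := by
    linear_combination hc - hc₂
  have e₂ : X 0 * (A + diff A₁ + X 1 * D₁) + X 2 * (D + diff D₁) = 0 := by
    linear_combination hb - hb₂
  obtain ⟨u, hu⟩ : X 0 ∣ D + diff D₁ := by
    apply X0_dvd
    apply mul_left_cancel₀ (X_ne_zero (R := ZMod 2) (1 : Fin 3))
    simpa using congrArg (aeval ![(0 : Model), X 1, X 2]) e₁
  have e₃ : B + diff B₁ = X 1 * u := by
    apply mul_left_cancel₀ (X_ne_zero (R := ZMod 2) (0 : Fin 3))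
    linear_combination e₁ - X 1 * hu - X 0 * X 1 * u * two_eq_zero
  have e₄ : A + diff A₁ + X 1 * D₁ = X 2 * u := by
    apply mul_left_cancel₀ (X_ne_zero (R := ZMod 2) (0 : Fin 3))
    linear_combination e₂ - X 2 * hu - X 0 * X 2 * u * two_eq_zero
  have hu₂ := congrArg diff hu
  simp only [map_add, diff_X0_mul, diff_diff] at hu₂
  have e₅ : E = diff u := by
    apply mul_left_cancel₀ (X_ne_zero (R := ZMod 2) (0 : Fin 3))
    linear_combination hD - hu₂ - X 0 * diff u * two_eq_zero
  refine ⟨a₁, b₁, c₁, A₁, B₁, D₁, u, e₅, ?_, ?_, ?_, ?_, ?_, ?_⟩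
  · linear_combination hu - diff D₁ * two_eq_zero
  · linear_combination e₃ - diff B₁ * two_eq_zero
  · linear_combination e₄ - (diff A₁ + X 1 * D₁) * two_eq_zero
  · linear_combination hc₁ - diff c₁ * two_eq_zero
  · linear_combination hb₁ - diff b₁ * two_eq_zero
  · linear_combination ha₁ - (diff a₁ + X 1 * c₁) * two_eq_zero

end PolyModel

/-! ### The monomial basis of `A(1)_*/τ` -/

namespace A1ModTau

open MvPolynomial PolyModel TensorAlgebra

/-- The exponents (of `τ₀`, `τ₁`, `ξ₁`) of the squarefree monomials, the constant one first. The
order of the others is such that the right hand factors in the reduced coproduct of a monomial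
precede that monomial. -/
def expVec : Fin 8 → Fin 3 → ℕ :=
  ![![0, 0, 0], ![1, 0, 0], ![0, 0, 1], ![0, 1, 0], ![1, 0, 1], ![1, 1, 0], ![0, 1, 1], ![1, 1, 1]]

/-- `expVec` as a finitely supported function. -/
def expo (i : Fin 8) : Fin 3 →₀ ℕ := Finsupp.equivFunOnFinite.symm (expVec i)

/-- The squarefree monomials of `A(1)_*/τ`. -/
def mon (i : Fin 8) : A1ModTau := mk (monomial (expo i) 1)

lemma mon_eq : mon = ![1, τ₀, ξ₁, τ₁, τ₀ * ξ₁, τ₀ * τ₁, ξ₁ * τ₁, τ₀ * ξ₁ * τ₁] := by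
  funext i
  have h : mon i = τ₀ ^ expVec i 0 * τ₁ ^ expVec i 1 * ξ₁ ^ expVec i 2 := by
    rw [mon, monomial_eq, Finsupp.prod_fintype _ _ (by simp)]
    simp [Fin.prod_univ_three, expo, τ₀, τ₁, ξ₁]
  rw [h]
  fin_cases i <;> simp [expVec] <;> ring

lemma expo_injective : Function.Injective expo := by
  intro i j h
  have h' : expVec i = expVec j := Finsupp.equivFunOnFinite.symm.injective h
  have key : ∀ i j, expVec i = expVec j → i = j := by decide
  exact key i j h'

lemma expo_lt (i : Fin 8) (k : Fin 3) : expo i k < 2 := by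
  change expVec i k < 2
  revert i k
  decide

lemma exists_expo {n : Fin 3 →₀ ℕ} (hn : ∀ k, n k < 2) : ∃ i, n = expo i := by
  have key : ∀ m : Fin 3 → Fin 2, ∃ i, ∀ k, (m k : ℕ) = expVec i k := by decide
  obtain ⟨i, hi⟩ := key fun k => ⟨n k, hn k⟩
  exact ⟨i, Finsupp.ext hi⟩

lemma mk_monomial_eq_zero {n : Fin 3 →₀ ℕ} {k : Fin 3} (hk : 2 ≤ n k) (c : ZMod 2) :
    mk (monomial n c) = 0 := by
  have h : monomial n c = monomial (n - Finsupp.single k 2) c * X k ^ 2 := by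
    rw [X_pow_eq_monomial, monomial_mul, tsub_add_cancel_of_le (by simpa using hk), mul_one]
  have hX : mk (X k) ^ 2 = 0 := by
    fin_cases k
    exacts [τ₀_sq, τ₁_sq, ξ₁_sq]
  rw [h, map_mul, map_pow, hX, mul_zero]

/-- The coefficient of a squarefree monomial, as a functional on `A(1)_*/τ`. -/
def coord (i : Fin 8) : A1ModTau →ₗ[ZMod 2] ZMod 2 :=
  (relations.restrictScalars (ZMod 2)).liftQ (lcoeff (ZMod 2) (expo i)) (by
    have key : ∀ (k : Fin 3) (p : MvPolynomial (Fin 3) (ZMod 2)),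
        coeff (expo i) (p * X k ^ 2) = 0 := by
      intro k p
      rw [X_pow_eq_monomial, coeff_mul_monomial', if_neg]
      have := expo_lt i k
      simpa using this
    intro x hx
    obtain ⟨a, y, hy, rfl⟩ := Ideal.mem_span_insert.1 hx
    obtain ⟨b, c, rfl⟩ := Ideal.mem_span_pair.1 hy
    simp [key])

lemma coord_mk (i : Fin 8) (p : MvPolynomial (Fin 3) (ZMod 2)) :
    coord i (mk p) = coeff (expo i) p := rfl

lemma coord_mon (i j : Fin 8) : coord i (mon j) = if i = j then 1 else 0 := by
  rw [mon, coord_mk, coeff_monomial]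
  simp [expo_injective.eq_iff, eq_comm]

lemma sum_coord (a : A1ModTau) : ∑ i, coord i a • mon i = a := by
  obtain ⟨p, rfl⟩ : ∃ p, mk p = a := Ideal.Quotient.mkₐ_surjective _ _ a
  induction p using MvPolynomial.induction_on' with
  | add p q hp hq =>
    simp only [map_add, add_smul, Finset.sum_add_distrib, hp, hq]
  | monomial n c =>
    by_cases hn : ∀ k, n k < 2
    · obtain ⟨j, rfl⟩ := exists_expo hn
      simp only [coord_mk, coeff_monomial, expo_injective.eq_iff, ite_smul, zero_smul,
        Finset.sum_ite_eq, Finset.mem_univ, if_true]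
      simp [mon, ← map_smul]
    · push Not at hn
      obtain ⟨k, hk⟩ := hn
      rw [mk_monomial_eq_zero hk]
      simp

lemma counit_apply (a : A1ModTau) : Coalgebra.counit (R := ZMod 2) a = counitHom a := rfl

lemma comul_apply (a : A1ModTau) : Coalgebra.comul (R := ZMod 2) a = comulHom a := rfl

lemma counit_mon (i : Fin 8) :
    Coalgebra.counit (R := ZMod 2) (mon i) = if i = 0 then 1 else 0 := by
  rw [counit_apply, mon_eq]
  fin_cases i <;> simp [counitHom]

lemma coord_zero (a : A1ModTau) : coord 0 a = Coalgebra.counit (R := ZMod 2) a := by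
  conv_rhs => rw [← sum_coord a]
  simp [counit_mon]

/-- The nonconstant squarefree monomials, as elements of the augmentation ideal. -/
def augMon (i : Fin 7) : Cobar.Aug A1ModTau :=
  ⟨mon i.succ, by simp [counit_mon]⟩

/-- The basis `τ₀, ξ₁, τ₁, τ₀ξ₁, τ₀τ₁, ξ₁τ₁, τ₀ξ₁τ₁` of the augmentation ideal. -/
def augBasis : Module.Basis (Fin 7) (ZMod 2) (Cobar.Aug A1ModTau) :=
  .ofEquivFun
    { toFun := fun a i => coord i.succ a
      map_add' := fun a b => by ext; simp
      map_smul' := fun c a => by ext; simp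
      invFun := fun v => ∑ i, v i • augMon i
      left_inv := fun a => by
        apply Subtype.ext
        have h0 : coord 0 (a : A1ModTau) = 0 := by rw [coord_zero]; exact a.2
        conv_rhs => rw [← sum_coord a, Fin.sum_univ_succ, h0]
        simp [augMon]
      right_inv := fun v => by
        ext i
        simp [augMon, coord_mon] }

lemma augBasis_coord (i : Fin 7) (a : Cobar.Aug A1ModTau) :
    augBasis.coord i a = coord i.succ a := by
  simp [augBasis]

lemma augBasis_apply (i : Fin 7) : augBasis i = augMon i := by
  apply augBasis.repr.injective
  ext j
  have := augBasis_coord j (augMon i)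
  rw [Module.Basis.coord_apply] at this
  rw [this, Module.Basis.repr_self, augMon, coord_mon, Finsupp.single_apply]
  simp [eq_comm]

lemma proj_mon_succ (i : Fin 7) : Cobar.proj A1ModTau (mon i.succ) = augBasis i := by
  apply Subtype.ext
  rw [augBasis_apply, Cobar.proj_coe]
  simp [counit_mon, augMon]

/-! ### The reduced coproduct -/

lemma comul_τ₀ : comulHom τ₀ = τ₀ ⊗ₜ[ZMod 2] 1 + 1 ⊗ₜ[ZMod 2] τ₀ := by simp [comulHom]

lemma comul_ξ₁ : comulHom ξ₁ = ξ₁ ⊗ₜ[ZMod 2] 1 + 1 ⊗ₜ[ZMod 2] ξ₁ := by simp [comulHom]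

lemma comul_τ₁ : comulHom τ₁ =
    τ₁ ⊗ₜ[ZMod 2] 1 + ξ₁ ⊗ₜ[ZMod 2] τ₀ + 1 ⊗ₜ[ZMod 2] τ₁ := by simp [comulHom]

/-- The reduced coproduct of each monomial, in terms of the monomial basis. -/
def redTable : Fin 7 → Cobar.Aug A1ModTau ⊗[ZMod 2] Cobar.Aug A1ModTau :=
  let e := augBasis
  ![0, 0, e 1 ⊗ₜ e 0, e 0 ⊗ₜ e 1 + e 1 ⊗ₜ e 0, e 0 ⊗ₜ e 2 + e 2 ⊗ₜ e 0 + e 3 ⊗ₜ e 0,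
    e 1 ⊗ₜ e 2 + e 2 ⊗ₜ e 1 + e 1 ⊗ₜ e 3,
    e 0 ⊗ₜ e 5 + e 1 ⊗ₜ e 4 + e 2 ⊗ₜ e 3 + e 3 ⊗ₜ e 2 + e 3 ⊗ₜ e 3 + e 4 ⊗ₜ e 1 + e 5 ⊗ₜ e 0]

lemma redComul_augBasis (i : Fin 7) : Cobar.redComul A1ModTau (augBasis i) = redTable i := by
  have hx' : ξ₁ * ξ₁ = 0 := by rw [← sq, ξ₁_sq]
  have ht (a : A1ModTau) : τ₀ * (τ₀ * a) = 0 := by rw [← mul_assoc, ← sq, τ₀_sq, zero_mul]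
  have ht' : τ₀ * τ₀ = 0 := by rw [← sq, τ₀_sq]
  have hc : ξ₁ * τ₀ = τ₀ * ξ₁ := mul_comm _ _
  have p1 : Cobar.proj A1ModTau 1 = 0 := by
    simpa using Cobar.proj_algebraMap A1ModTau 1
  have p : ∀ i : Fin 7, Cobar.proj A1ModTau
      ((![τ₀, ξ₁, τ₁, τ₀ * ξ₁, τ₀ * τ₁, ξ₁ * τ₁, τ₀ * (ξ₁ * τ₁)] : Fin 7 → A1ModTau) i) =
        augBasis i := by
    intro i
    rw [← proj_mon_succ, mon_eq]
    fin_cases i <;> simp [mul_assoc]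
  have q0 := p 0
  have q1 := p 1
  have q2 := p 2
  have q3 := p 3
  have q4 := p 4
  have q5 := p 5
  have q6 := p 6
  simp only [Matrix.cons_val] at q0 q1 q2 q3 q4 q5 q6
  rw [← p i, Cobar.redComul_proj, comul_apply]
  fin_cases i <;>
  simp [redTable, comul_τ₀, comul_τ₁, comul_ξ₁, add_mul, mul_add, hx', ht, ht', hc,
    p1, q0, q1, q2, q3, q4, q5, q6] <;> abel

/-! ### Comparison of the cobar complex with the polynomial model -/

/-- The cobar complex of `A(1)_*/τ`. -/
abbrev CobarCx : Type := Cobar.Complex A1ModTau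

/-- The one-letter words on the monomial basis. -/
def letter (i : Fin 7) : CobarCx := ι (ZMod 2) (augBasis i)

/-- The images of the one-letter words in the polynomial model. -/
def gen : Fin 7 → Model := ![X 0, X 1, X 2, 0, 0, 0, 0]

/-- The comparison map `[τ₀] ↦ h₀`, `[ξ₁] ↦ h₁`, `[τ₁] ↦ v`, which kills the letters that are
decomposable monomials. -/
def toModel : CobarCx →ₐ[ZMod 2] Model :=
  TensorAlgebra.lift (ZMod 2) (augBasis.constr (ZMod 2) gen)

@[simp] lemma toModel_letter (i : Fin 7) : toModel (letter i) = gen i := by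
  simp [toModel, letter]

@[simp] lemma incl₂_augBasis (i j : Fin 7) :
    Cobar.incl₂ A1ModTau (augBasis i ⊗ₜ augBasis j) = letter i * letter j := by
  simp [Cobar.incl₂, letter]

lemma d_letter (i : Fin 7) :
    Cobar.d A1ModTau (letter i) = Cobar.incl₂ A1ModTau (redTable i) := by
  rw [letter, Cobar.d_ι, redComul_augBasis]

lemma model_add_self (p : Model) : p + p = 0 := CharTwo.add_self_eq_zero p

lemma toModel_d_letter (i : Fin 7) :
    toModel (Cobar.d A1ModTau (letter i)) = diff (gen i) := by
  rw [d_letter]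
  fin_cases i <;>
    simp [redTable, gen, mul_comm (X 1 : Model) (X 0), mul_comm (X 2 : Model) (X 0),
      mul_comm (X 2 : Model) (X 1), model_add_self]

/-- The comparison map is a map of differential graded algebras. -/
lemma toModel_d (x : CobarCx) : toModel (Cobar.d A1ModTau x) = diff (toModel x) := by
  induction x using TensorAlgebra.induction with
  | algebraMap c => simp [Cobar.d_algebraMap]
  | add x y hx hy => simp [hx, hy]
  | mul x y hx hy =>
    rw [Cobar.d_mul, map_add, map_mul, map_mul, map_mul, diff_mul, hx, hy]
    ring
  | ι a =>
    have : toModel.toLinearMap ∘ₗ Cobar.d A1ModTau ∘ₗ ι (ZMod 2) =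
        diff.toLinearMap ∘ₗ toModel.toLinearMap ∘ₗ ι (ZMod 2) := by
      refine augBasis.ext fun i => ?_
      exact (toModel_d_letter i).trans (congrArg diff (toModel_letter i).symm)
    exact DFunLike.congr_fun this a

lemma constantCoeff_toModel (x : CobarCx) :
    constantCoeff (toModel x) = algebraMapInv x := by
  induction x using TensorAlgebra.induction with
  | algebraMap c => simp
  | add x y hx hy => simp [hx, hy]
  | mul x y hx hy => simp [hx, hy]
  | ι a =>
    rw [algebraMapInv_ι, ← augBasis.sum_repr a]
    have : ∀ i, constantCoeff (toModel (ι (ZMod 2) (augBasis i))) = 0 := by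
      intro i
      rw [← letter, toModel_letter]
      fin_cases i <;> simp [gen]
    simp only [map_sum, map_smul, constantCoeff_smul, this, smul_zero, Finset.sum_const_zero]

/-! ### The twisting coefficients -/

/-- The coefficient of the `i`-th letter in last position in `d` of the `j`-th letter. -/
def twist (i j : Fin 7) : CobarCx :=
  contractRight (augBasis.coord i) (Cobar.d A1ModTau (letter j))

@[simp] lemma contractRight_mul_letter (i j : Fin 7) (x : CobarCx) :
    contractRight (augBasis.coord i) (x * letter j) = if j = i then x else 0 := by
  rw [letter, contractRight_mul_ι]
  simp [Finsupp.single_apply]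

/-- The reduced coproduct is triangular with respect to the order of the monomial basis. -/
lemma twist_eq_zero {i j : Fin 7} (h : j ≤ i) : twist i j = 0 := by
  rw [twist, d_letter]
  revert h
  fin_cases j <;> fin_cases i <;> simp [redTable]

lemma incl₂_mem_homogeneous (t : Cobar.Aug A1ModTau ⊗[ZMod 2] Cobar.Aug A1ModTau) :
    Cobar.incl₂ A1ModTau t ∈ homogeneous (ZMod 2) (Cobar.Aug A1ModTau) 2 := by
  induction t using TensorProduct.induction_on with
  | zero => simp
  | add s t hs ht => rw [map_add]; exact add_mem hs ht
  | tmul a b =>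
    rw [homogeneous, pow_two]
    exact Submodule.mul_mem_mul ⟨a, rfl⟩ ⟨b, rfl⟩

lemma d_ι_mem_homogeneous (a : Cobar.Aug A1ModTau) :
    Cobar.d A1ModTau (ι (ZMod 2) a) ∈ homogeneous (ZMod 2) (Cobar.Aug A1ModTau) 2 := by
  rw [Cobar.d_ι]
  exact incl₂_mem_homogeneous _

lemma twist_mem_homogeneous (i j : Fin 7) :
    twist i j ∈ homogeneous (ZMod 2) (Cobar.Aug A1ModTau) 1 :=
  contractRight_mem_homogeneous _ (d_ι_mem_homogeneous _)

lemma d_mem_homogeneous {n : ℕ} {x : CobarCx}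
    (hx : x ∈ homogeneous (ZMod 2) (Cobar.Aug A1ModTau) n) :
    Cobar.d A1ModTau x ∈ homogeneous (ZMod 2) (Cobar.Aug A1ModTau) (n + 1) := by
  induction hx using homogeneous_induction with
  | algebraMap c => simp [Cobar.d_algebraMap]
  | add n x y _ _ hx hy => rw [map_add]; exact add_mem hx hy
  | mul_ι n x hx m ih =>
    rw [Cobar.d_mul]
    refine add_mem (mul_ι_mem_homogeneous ih m) ?_
    rw [homogeneous, add_assoc, pow_add]
    exact Submodule.mul_mem_mul hx (d_ι_mem_homogeneous m)

/-- The cobar differential in terms of the last letters of words: in positive degrees the cobar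
complex is a twisted tensor product of itself with the augmentation ideal. -/
lemma contractRight_d (i : Fin 7) (x : CobarCx) :
    contractRight (augBasis.coord i) (Cobar.d A1ModTau x) =
      Cobar.d A1ModTau (contractRight (augBasis.coord i) x) +
        ∑ j, contractRight (augBasis.coord j) x * twist i j := by
  have hx : x = algebraMap (ZMod 2) _ (algebraMapInv x) +
      ∑ j, contractRight (augBasis.coord j) x * letter j := eq_add_sum_contractRight augBasis x
  conv_lhs => rw [hx]
  have hε : ∀ j, algebraMapInv (Cobar.d A1ModTau (letter j)) = 0 := fun j =>
    algebraMapInv_eq_zero (d_ι_mem_homogeneous _)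
  simp only [map_add, map_sum, Cobar.d_algebraMap, zero_add, Cobar.d_mul,
    Finset.sum_add_distrib, contractRight_mul_letter]
  simp [contractRight_mul, hε, twist]

/-- The images of the twisting coefficients in the polynomial model. -/
lemma toModel_twist (i j : Fin 7) : toModel (twist i j) =
    (![![0, 0, X 1, X 1, X 2, 0, 0],
      ![0, 0, 0, X 0, 0, X 2, 0],
      ![0, 0, 0, 0, X 0, X 1, 0],
      ![0, 0, 0, 0, 0, X 1, X 2],
      ![0, 0, 0, 0, 0, 0, X 1],
      ![0, 0, 0, 0, 0, 0, X 0],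
      ![0, 0, 0, 0, 0, 0, 0]] : Matrix (Fin 7) (Fin 7) Model) i j := by
  rw [twist, d_letter]
  fin_cases j <;> fin_cases i <;> simp [redTable, gen]

/-- The differential of the twisted tensor product of the polynomial model with the augmentation
ideal, in coordinates. -/
def twistedDiff (y : Fin 7 → Model) (i : Fin 7) : Model :=
  diff (y i) + ∑ j, y j * toModel (twist i j)

/-- A cycle of the twisted tensor product is a boundary if its product in the polynomial model is
one. -/
lemma twistedDiff_exact {y : Fin 7 → Model} {s : Model} (hy : ∀ i, twistedDiff y i = 0)
    (hs : ∑ i, y i * gen i = diff s) : ∃ y', ∀ i, y i = twistedDiff y' i := by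
  have h := koszul_exact (s := s) (a := y 0) (b := y 1) (c := y 2) (A := y 3) (B := y 4)
    (D := y 5) (E := y 6)
    (by simpa [twistedDiff, toModel_twist, Fin.sum_univ_seven, mul_comm, add_assoc] using hy 5)
    (by simpa [twistedDiff, toModel_twist, Fin.sum_univ_seven, mul_comm, add_assoc] using hy 2)
    (by simpa [twistedDiff, toModel_twist, Fin.sum_univ_seven, mul_comm, add_assoc] using hy 1)
    (by
      rw [← hs]
      simp only [gen, Fin.sum_univ_seven, Matrix.cons_val]
      linear_combination (X 0 * y 0 + X 1 * y 1 + X 2 * y 2) * two_eq_zero)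
  obtain ⟨a, b, c, A, B, D, E, hE, hD, hB, hA, hc, hb, ha⟩ := h
  refine ⟨![a, b, c, A, B, D, E], fun i => ?_⟩
  fin_cases i <;> simp [twistedDiff, toModel_twist, Fin.sum_univ_seven] <;> grind

/-! ### The comparison map is a quasi-isomorphism -/

/-- The cocycle `[τ₁|τ₁] + [ξ₁|τ₀τ₁] + [ξ₁τ₁|τ₀]`, which represents the third generator. -/
def bCocycle : CobarCx := letter 2 * letter 2 + letter 1 * letter 4 + letter 5 * letter 0

lemma d_bCocycle : Cobar.d A1ModTau bCocycle = 0 := by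
  have h2 : ∀ x : CobarCx, (2 : ℤ) • x = 0 := fun x => by
    rw [two_zsmul, Cobar.add_self]
  simp only [bCocycle, map_add, Cobar.d_mul, d_letter, redTable, Matrix.cons_val, map_zero,
    incl₂_augBasis, add_mul, mul_add, mul_assoc, zero_mul, mul_zero]
  abel_nf
  simp only [h2, add_zero]

@[simp] lemma toModel_bCocycle : toModel bCocycle = X 2 ^ 2 := by
  simp [bCocycle, gen, sq]

lemma d_letter_zero : Cobar.d A1ModTau (letter 0) = 0 := by simp [d_letter, redTable]

lemma d_letter_one : Cobar.d A1ModTau (letter 1) = 0 := by simp [d_letter, redTable]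

/-- The generating cocycles. -/
def cocycleGen : Fin 3 → Cobar.cocycles A1ModTau :=
  ![⟨letter 0, d_letter_zero⟩, ⟨letter 1, d_letter_one⟩, ⟨bCocycle, d_bCocycle⟩]

lemma toModel_cocycleGen (i : Fin 3) : toModel (cocycleGen i) = sqMap (X i) := by
  fin_cases i <;> simp [cocycleGen, sqMap, gen]

lemma range_sqMap_le :
    sqMap.range ≤ (Cobar.cocycles A1ModTau).map toModel := by
  rw [sqMap, ← Algebra.adjoin_range_eq_range_aeval, Algebra.adjoin_le_iff]
  rintro _ ⟨i, rfl⟩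
  refine ⟨cocycleGen i, (cocycleGen i).2, ?_⟩
  simpa [sqMap] using toModel_cocycleGen i

/-- The component of an element of the cobar complex in filtration (word length) `n`. -/
def comp (n : ℕ) (x : CobarCx) : CobarCx :=
  DirectSum.decompose (homogeneous (ZMod 2) (Cobar.Aug A1ModTau)) x n

lemma comp_mem (n : ℕ) (x : CobarCx) :
    comp n x ∈ homogeneous (ZMod 2) (Cobar.Aug A1ModTau) n := Subtype.prop _

lemma d_comp (n : ℕ) (x : CobarCx) :
    Cobar.d A1ModTau (comp n x) = comp (n + 1) (Cobar.d A1ModTau x) :=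
  (DirectSum.decompose_map_apply _ _ (Cobar.d A1ModTau) (add_left_injective 1)
    (fun _ _ => d_mem_homogeneous) n x).symm

lemma gen_isHomogeneous (i : Fin 7) : (gen i).IsHomogeneous 1 := by
  fin_cases i <;> simp [gen, isHomogeneous_X, isHomogeneous_zero]

lemma toModel_ι_isHomogeneous (a : Cobar.Aug A1ModTau) :
    (toModel (ι (ZMod 2) a)).IsHomogeneous 1 := by
  rw [← augBasis.sum_repr a, map_sum, map_sum]
  refine IsHomogeneous.sum _ _ _ fun i _ => ?_
  rw [map_smul, map_smul, ← letter, toModel_letter, smul_eq_C_mul]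
  simpa using (isHomogeneous_C (Fin 3) _).mul (gen_isHomogeneous i)

lemma toModel_isHomogeneous {n : ℕ} {x : CobarCx}
    (hx : x ∈ homogeneous (ZMod 2) (Cobar.Aug A1ModTau) n) : (toModel x).IsHomogeneous n := by
  induction hx using homogeneous_induction with
  | algebraMap c =>
    rw [AlgHom.commutes]
    exact isHomogeneous_C _ _
  | add n x y _ _ hx hy => rw [map_add]; exact hx.add hy
  | mul_ι n x hx m ih =>
    rw [map_mul]
    exact ih.mul (toModel_ι_isHomogeneous m)

lemma toModel_comp (n : ℕ) (x : CobarCx) :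
    toModel (comp n x) = homogeneousComponent n (toModel x) :=
  (weightedHomogeneousComponent_map (homogeneous (ZMod 2) (Cobar.Aug A1ModTau)) 1
    toModel.toLinearMap Function.injective_id (fun _ _ => toModel_isHomogeneous) n x).symm

lemma diff_isHomogeneous {n : ℕ} {p : Model} (hp : p.IsHomogeneous n) :
    (diff p).IsHomogeneous (n + 1) := by
  rw [diff_apply]
  rcases n with _ | n
  · rw [← totalDegree_zero_iff_isHomogeneous, totalDegree_eq_zero_iff_eq_C] at hp
    rw [hp]
    simp [isHomogeneous_zero]
  · have := ((isHomogeneous_X (ZMod 2) (0 : Fin 3)).mul (isHomogeneous_X _ 1)).mul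
      (hp.pderiv (i := 2))
    convert this using 1
    omega

lemma homogeneousComponent_diff (n : ℕ) (p : Model) :
    homogeneousComponent (n + 1) (diff p) = diff (homogeneousComponent n p) :=
  weightedHomogeneousComponent_map' 1 1 diff.toLinearMap (add_left_injective 1)
    (fun _ _ => diff_isHomogeneous) n p

lemma homogeneousComponent_mul_right (n : ℕ) (p : Model) {q : Model} (hq : q.IsHomogeneous 1) :
    homogeneousComponent (n + 1) (p * q) = homogeneousComponent n p * q :=
  weightedHomogeneousComponent_map' 1 1 (LinearMap.mulRight (ZMod 2) q) (add_left_injective 1)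
    (fun _ _ h => IsHomogeneous.mul h hq) n p

lemma homogeneousComponent_twistedDiff (n : ℕ) (y : Fin 7 → Model) (i : Fin 7) :
    homogeneousComponent (n + 1) (twistedDiff y i) =
      twistedDiff (fun j => homogeneousComponent n (y j)) i := by
  simp only [twistedDiff, map_add, map_sum, homogeneousComponent_diff,
    homogeneousComponent_mul_right n _ (toModel_isHomogeneous (twist_mem_homogeneous _ _))]

/-- Every homogeneous cycle of the polynomial model lifts to a homogeneous cocycle. -/
lemma exists_cocycle_lift {n : ℕ} {p : Model} (hp : p.IsHomogeneous n) (hd : diff p = 0) :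
    ∃ w ∈ homogeneous (ZMod 2) (Cobar.Aug A1ModTau) n, Cobar.d A1ModTau w = 0 ∧
      toModel w = p := by
  obtain ⟨w, hw, hwp⟩ := range_sqMap_le (mem_range_sqMap hd)
  have hw : Cobar.d A1ModTau w = 0 := hw
  have hwp : toModel w = p := hwp
  refine ⟨comp n w, comp_mem _ _, ?_, ?_⟩
  · rw [d_comp, hw]
    simp [comp]
  · rw [toModel_comp, hwp, homogeneousComponent_of_mem hp, if_pos rfl]

/-- The descent on the last letters: if the cocycle `x` is, letterwise, mapped to the boundary of
`y`, and only the first `k` letters occur in last position, then `x` is a coboundary, provided that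
the comparison map is injective on cohomology one degree lower. -/
lemma exists_primitive_step {n : ℕ}
    (ih : ∀ x ∈ homogeneous (ZMod 2) (Cobar.Aug A1ModTau) (n + 1), Cobar.d A1ModTau x = 0 →
      (∃ s, toModel x = diff s) →
        ∃ z ∈ homogeneous (ZMod 2) (Cobar.Aug A1ModTau) n, Cobar.d A1ModTau z = x)
    (k : ℕ) {x : CobarCx} (hx : x ∈ homogeneous (ZMod 2) (Cobar.Aug A1ModTau) (n + 2))
    (hd : Cobar.d A1ModTau x = 0) {y : Fin 7 → Model} (hy : ∀ i, (y i).IsHomogeneous n)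
    (hxy : ∀ i, toModel (contractRight (augBasis.coord i) x) = twistedDiff y i)
    (hk : ∀ i : Fin 7, k ≤ i → contractRight (augBasis.coord i) x = 0 ∧ y i = 0) :
    ∃ z ∈ homogeneous (ZMod 2) (Cobar.Aug A1ModTau) (n + 1), Cobar.d A1ModTau z = x := by
  induction k generalizing x y with
  | zero =>
    refine ⟨0, zero_mem _, ?_⟩
    rw [map_zero, eq_add_sum_contractRight augBasis x, algebraMapInv_eq_zero hx]
    simp [fun i => (hk i (Nat.zero_le _)).1]
  | succ k ihk =>
    by_cases hk7 : 7 ≤ k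
    · exact ihk hx hd hy hxy fun i hi => by omega
    obtain ⟨t, rfl⟩ : ∃ t : Fin 7, (t : ℕ) = k := ⟨⟨k, by omega⟩, rfl⟩
    -- the coefficient of the largest letter is a cocycle whose image is the boundary of `y t`
    have hzero : ∀ j, (contractRight (augBasis.coord j) x) * twist t j = 0 ∧
        y j * toModel (twist t j) = 0 := by
      intro j
      rcases le_or_gt j t with h | h
      · simp [twist_eq_zero h]
      · simp [hk j h]
    have hdt : Cobar.d A1ModTau (contractRight (augBasis.coord t) x) = 0 := by
      have := contractRight_d t x
      simpa [hd, fun j => (hzero j).1] using this.symm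
    have hyt : toModel (contractRight (augBasis.coord t) x) = diff (y t) := by
      rw [hxy, twistedDiff]
      simp [fun j => (hzero j).2]
    obtain ⟨z, hz, hdz⟩ := ih _ (contractRight_mem_homogeneous _ hx) hdt ⟨_, hyt⟩
    -- correct `z` by a cocycle, so that it lifts `y t`
    obtain ⟨w, hw, hdw, hwz⟩ := exists_cocycle_lift ((toModel_isHomogeneous hz).sub (hy t))
      (by rw [map_sub, ← toModel_d, hdz, hyt, sub_self])
    obtain ⟨u, hu, hdu, huy⟩ : ∃ u ∈ homogeneous (ZMod 2) (Cobar.Aug A1ModTau) n,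
        Cobar.d A1ModTau u = contractRight (augBasis.coord t) x ∧ toModel u = y t :=
      ⟨z - w, sub_mem hz hw, by rw [map_sub, hdz, hdw, sub_zero], by rw [map_sub, hwz]; abel⟩
    have hc : ∀ i, contractRight (augBasis.coord i) (x - Cobar.d A1ModTau (u * letter t)) =
        contractRight (augBasis.coord i) x -
          ((if t = i then contractRight (augBasis.coord t) x else 0) + u * twist i t) := by
      intro i
      rw [map_sub, contractRight_d, contractRight_mul_letter]
      congr 2
      · split_ifs
        · exact hdu
        · exact map_zero _
      · rw [Finset.sum_eq_single t]
        · simp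
        · intro j _ hj
          rw [contractRight_mul_letter, if_neg hj.symm, zero_mul]
        · simp
    obtain ⟨z', hz', hdz'⟩ := ihk (x := x - Cobar.d A1ModTau (u * letter t))
      (y := y - Pi.single t (y t))
      (sub_mem hx (d_mem_homogeneous (mul_ι_mem_homogeneous hu _)))
      (by rw [map_sub, hd, Cobar.d_d, sub_zero])
      (by
        intro i
        refine (hy i).sub ?_
        by_cases h : i = t
        · subst h; simpa using hy i
        · simpa [h] using isHomogeneous_zero _ _ _)
      (by
        intro i
        rw [hc, map_sub, map_add, map_mul, hxy, huy, apply_ite toModel, hyt, map_zero]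
        simp only [twistedDiff, Pi.sub_apply, sub_mul, Finset.sum_sub_distrib, map_sub]
        rw [Finset.sum_eq_single_of_mem t (Finset.mem_univ _)
          (f := fun j => (Pi.single t (y t) : Fin 7 → Model) j * toModel (twist i j))
          (by intro j _ hj; simp [hj])]
        by_cases h : t = i
        · subst h; simp
        · simp [h, Ne.symm h]; ring)
      (by
        intro i hi
        rw [hc, twist_eq_zero (Fin.le_def.2 hi)]
        by_cases h : t = i
        · subst h; simp
        · have hlt : (t : ℕ) + 1 ≤ i := by
            have : (t : ℕ) ≠ i := fun h' => h (Fin.ext h')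
            omega
          simp [h, Ne.symm h, hk i hlt])
    exact ⟨z' + u * letter t, add_mem hz' (mul_ι_mem_homogeneous hu _), by
      rw [map_add, hdz', sub_add_cancel]⟩

/-- A cocycle of the cobar complex whose image is a boundary is, letterwise, mapped to a boundary of
the twisted tensor product. -/
lemma exists_twistedDiff {x : CobarCx} (hd : Cobar.d A1ModTau x = 0)
    {s : Model} (hs : toModel x = diff s) (hε : algebraMapInv x = 0) :
    ∃ y, ∀ i, toModel (contractRight (augBasis.coord i) x) = twistedDiff y i := by
  refine twistedDiff_exact (s := s) (fun i => ?_) ?_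
  · have := congrArg toModel (contractRight_d i x)
    rw [hd, map_zero, map_zero, map_add, toModel_d, map_sum] at this
    simpa [twistedDiff] using this.symm
  · rw [← hs]
    conv_rhs => rw [eq_add_sum_contractRight augBasis x, hε]
    simp [← letter.eq_1]

/-- The comparison map is injective on cohomology, in each positive degree. -/
lemma exists_primitive (n : ℕ) : ∀ x ∈ homogeneous (ZMod 2) (Cobar.Aug A1ModTau) (n + 1),
    Cobar.d A1ModTau x = 0 → (∃ s, toModel x = diff s) →
      ∃ z ∈ homogeneous (ZMod 2) (Cobar.Aug A1ModTau) n, Cobar.d A1ModTau z = x := by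
  induction n with
  | zero =>
    rintro x hx hd ⟨s, hs⟩
    obtain ⟨y, hy⟩ := exists_twistedDiff hd hs (algebraMapInv_eq_zero hx)
    refine ⟨0, zero_mem _, ?_⟩
    rw [map_zero, eq_add_sum_contractRight augBasis x, algebraMapInv_eq_zero hx, map_zero,
      zero_add, eq_comm]
    refine Finset.sum_eq_zero fun i _ => ?_
    -- the coefficients of the letters are constants, and boundaries have no constant term
    have hi := contractRight_mem_homogeneous (augBasis.coord i) hx
    rw [homogeneous, pow_zero, Submodule.mem_one] at hi
    obtain ⟨c, hc⟩ := hi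
    have h := congrArg constantCoeff (hy i)
    rw [twistedDiff, map_add, constantCoeff_diff, map_sum, constantCoeff_toModel, ← hc,
      algebraMapInv_algebraMap] at h
    simp only [map_mul, constantCoeff_toModel, algebraMapInv_eq_zero (twist_mem_homogeneous _ _),
      mul_zero, Finset.sum_const_zero, add_zero] at h
    rw [← hc, h, map_zero, zero_mul]
  | succ n ih =>
    rintro x hx hd ⟨s, hs⟩
    obtain ⟨y, hy⟩ := exists_twistedDiff hd hs (algebraMapInv_eq_zero hx)
    refine exists_primitive_step ih 7 hx hd
      (y := fun i => homogeneousComponent n (y i))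
      (fun i => homogeneousComponent_isHomogeneous _ _) (fun i => ?_) (fun i hi => by omega)
    rw [← homogeneousComponent_twistedDiff, ← hy, homogeneousComponent_of_mem
      (toModel_isHomogeneous (contractRight_mem_homogeneous _ hx)), if_pos rfl]

/-- The comparison map is injective on cohomology. -/
lemma exists_d_eq {x : CobarCx} (hd : Cobar.d A1ModTau x = 0) {s : Model}
    (hs : toModel x = diff s) : ∃ z, x = Cobar.d A1ModTau z := by
  classical
  suffices h : x ∈ LinearMap.range (Cobar.d A1ModTau) by
    obtain ⟨z, hz⟩ := h
    exact ⟨z, hz.symm⟩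
  rw [← DirectSum.sum_support_decompose (homogeneous (ZMod 2) (Cobar.Aug A1ModTau)) x]
  refine sum_mem fun n _ => ?_
  change comp n x ∈ _
  rcases n with _ | n
  · have h0 := comp_mem 0 x
    rw [homogeneous, pow_zero, Submodule.mem_one] at h0
    obtain ⟨c, hc⟩ := h0
    have h := toModel_comp 0 x
    rw [hs, homogeneousComponent_zero, ← constantCoeff_eq, constantCoeff_diff, ← hc,
      AlgHom.commutes, map_zero] at h
    have hc0 : c = 0 := (algebraMap (ZMod 2) Model).injective (by simpa using h)
    rw [← hc, hc0, map_zero]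
    exact zero_mem _
  · obtain ⟨z, -, hz⟩ := exists_primitive n (comp (n + 1) x) (comp_mem _ _)
      (by rw [d_comp, hd]; simp [comp])
      ⟨homogeneousComponent n s, by rw [toModel_comp, hs, homogeneousComponent_diff]⟩
    exact ⟨z, hz⟩

/-! ### The isomorphism -/

/-- The ideal `(h₀ h₁)`. -/
abbrev relIdeal : Ideal Model := Ideal.span {X 0 * X 1}

/-- The map `Ext → 𝔽₂[h₀, h₁, v] / (h₀ h₁)` induced by the comparison map; note that the target is
`ExtRing` as a ring, with `v` in place of the third generator. -/
def extToRing : Cobar.Ext A1ModTau →ₐ[ZMod 2] ExtRing :=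
  RingCon.liftₐ _ ((Ideal.Quotient.mkₐ (ZMod 2) relIdeal).comp
    (toModel.comp (Cobar.cocycles A1ModTau).val)) (by
      rintro x y ⟨z, hz⟩
      refine Ideal.Quotient.eq.2 ?_
      change toModel x - toModel y ∈ relIdeal
      rw [hz, map_add, toModel_d, add_sub_cancel_left, diff_apply]
      exact Ideal.mem_span_singleton.2 (dvd_mul_right _ _))

/-- The class of a cocycle. -/
def cls : Cobar.cocycles A1ModTau →ₐ[ZMod 2] Cobar.Ext A1ModTau :=
  (Cobar.cohomologous A1ModTau).mkₐ (α := ZMod 2)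

lemma cls_surjective : Function.Surjective cls := RingCon.mkₐ_surjective _

lemma extToRing_cls (x : Cobar.cocycles A1ModTau) :
    extToRing (cls x) = Ideal.Quotient.mkₐ (ZMod 2) relIdeal (toModel x) := rfl

lemma extToRing_injective : Function.Injective extToRing := by
  rw [injective_iff_map_eq_zero]
  intro x hx
  obtain ⟨x, rfl⟩ := cls_surjective x
  have hdx : Cobar.d A1ModTau x = 0 := x.2
  have hdvd : X 0 * X 1 ∣ toModel x := by
    rw [← Ideal.mem_span_singleton]
    exact Ideal.Quotient.eq_zero_iff_mem.1 hx
  obtain ⟨s, hs⟩ := exists_diff_of_dvd (by rw [← toModel_d, hdx, map_zero]) hdvd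
  obtain ⟨z, hz⟩ := exists_d_eq hdx hs
  rw [← map_zero cls]
  exact Quotient.sound ⟨z, by rw [ZeroMemClass.coe_zero, zero_add, hz]⟩

/-- The endomorphism `b ↦ v²` of `ExtRing`, regarded as a map
`𝔽₂[h₀, h₁, b] / (h₀ h₁) → 𝔽₂[h₀, h₁, v] / (h₀ h₁)`. -/
def sqRing : ExtRing →ₐ[ZMod 2] ExtRing :=
  Ideal.Quotient.liftₐ relIdeal ((Ideal.Quotient.mkₐ (ZMod 2) relIdeal).comp sqMap) (by
    intro p hp
    obtain ⟨q, rfl⟩ := Ideal.mem_span_singleton.1 hp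
    refine Ideal.Quotient.eq_zero_iff_mem.2 (Ideal.mem_span_singleton.2 ?_)
    exact ⟨sqMap q, by simp [sqMap]⟩)

lemma sqRing_mk (p : Model) : sqRing (Ideal.Quotient.mkₐ (ZMod 2) relIdeal p) =
    Ideal.Quotient.mkₐ (ZMod 2) relIdeal (sqMap p) := rfl

lemma sqRing_injective : Function.Injective sqRing := by
  rw [injective_iff_map_eq_zero]
  intro x hx
  obtain ⟨p, rfl⟩ := Ideal.Quotient.mkₐ_surjective (ZMod 2) relIdeal x
  refine Ideal.Quotient.eq_zero_iff_mem.2 (Ideal.mem_span_singleton.2 (dvd_of_dvd_sqMap ?_))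
  exact Ideal.mem_span_singleton.1 (Ideal.Quotient.eq_zero_iff_mem.1 hx)

lemma sqRing_range : sqRing.range = extToRing.range := by
  apply le_antisymm
  · rintro _ ⟨x, rfl⟩
    obtain ⟨p, rfl⟩ := Ideal.Quotient.mkₐ_surjective (ZMod 2) relIdeal x
    obtain ⟨w, hw, hwp⟩ := range_sqMap_le ⟨p, rfl⟩
    exact ⟨cls ⟨w, hw⟩, congrArg (Ideal.Quotient.mkₐ (ZMod 2) relIdeal) hwp⟩
  · rintro _ ⟨x, rfl⟩
    obtain ⟨x, rfl⟩ := cls_surjective x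
    have hdx : Cobar.d A1ModTau x = 0 := x.2
    obtain ⟨p, hp⟩ := mem_range_sqMap (p := toModel x) (by rw [← toModel_d, hdx, map_zero])
    exact ⟨Ideal.Quotient.mkₐ (ZMod 2) relIdeal p,
      congrArg (Ideal.Quotient.mkₐ (ZMod 2) relIdeal) hp⟩

/-- The isomorphism `𝔽₂[h₀, h₁, b] / (h₀ h₁) ≃ Ext`: both sides are the same subring of
`𝔽₂[h₀, h₁, v] / (h₀ h₁)`. -/
def extEquiv : ExtRing ≃ₐ[ZMod 2] Cobar.Ext A1ModTau :=
  (AlgEquiv.ofInjective sqRing sqRing_injective).trans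
    ((Subalgebra.equivOfEq _ _ sqRing_range).trans
      (AlgEquiv.ofInjective extToRing extToRing_injective).symm)

lemma extToRing_extEquiv (r : ExtRing) : extToRing (extEquiv r) = sqRing r := by
  have h := (AlgEquiv.ofInjective extToRing extToRing_injective).apply_symm_apply
    (Subalgebra.equivOfEq _ _ sqRing_range (AlgEquiv.ofInjective sqRing sqRing_injective r))
  exact congrArg Subtype.val h

lemma extEquiv_mk_X (i : Fin 3) :
    extEquiv (Ideal.Quotient.mkₐ (ZMod 2) relIdeal (X i)) = cls (cocycleGen i) := by
  apply extToRing_injective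
  rw [extToRing_extEquiv, sqRing_mk, extToRing_cls, toModel_cocycleGen]

/-! ### The trigrading of `Ext` -/

lemma complexGrade_mul {A : Type} [CommRing A] [Bialgebra (ZMod 2) A]
    (𝒜 : ℤ × ℤ → Submodule (ZMod 2) A) {f f' : ℕ} {e e' : ℤ × ℤ} {x y : Cobar.Complex A}
    (hx : x ∈ Cobar.complexGrade A 𝒜 f e) (hy : y ∈ Cobar.complexGrade A 𝒜 f' e') :
    x * y ∈ Cobar.complexGrade A 𝒜 (f + f') (e + e') := by
  have h := Submodule.mul_mem_mul hx hy
  rw [Cobar.complexGrade, Cobar.complexGrade, Submodule.span_mul_span] at h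
  refine Submodule.span_mono ?_ h
  rintro _ ⟨_, ⟨δ, a, ha, hδ, rfl⟩, _, ⟨δ', a', ha', hδ', rfl⟩, rfl⟩
  refine ⟨Fin.append δ δ', Fin.append a a', fun i => ?_, ?_, ?_⟩
  · refine Fin.addCases (fun i => ?_) (fun i => ?_) i
    · simpa using ha i
    · simpa using ha' i
  · simp [Fin.sum_univ_add, hδ, hδ']
  · simp only [TensorAlgebra.tprod_apply]
    rw [← List.prod_append, ← List.ofFn_fin_append]
    congr 2
    funext i
    refine Fin.addCases (fun i => ?_) (fun i => ?_) i <;> simp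

lemma extGrade_mul {n m : ℤ × ℕ × ℤ} {x y : Cobar.Ext A1ModTau}
    (hx : x ∈ Cobar.extGrade A1ModTau grade n) (hy : y ∈ Cobar.extGrade A1ModTau grade m) :
    x * y ∈ Cobar.extGrade A1ModTau grade (n + m) := by
  obtain ⟨x, hx, rfl⟩ := hx
  obtain ⟨y, hy, rfl⟩ := hy
  refine ⟨x * y, ?_, map_mul cls x y⟩
  have h := complexGrade_mul grade hx hy
  have he : ((n + m).1 + ((n + m).2.1 : ℤ), (n + m).2.2) =
      (n.1 + (n.2.1 : ℤ), n.2.2) + (m.1 + (m.2.1 : ℤ), m.2.2) := by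
    ext <;> simp
    ring
  change ((x * y : Cobar.cocycles A1ModTau) : CobarCx) ∈ Cobar.complexGrade _ _ _ _
  rw [he]
  exact h

lemma extGrade_one : (1 : Cobar.Ext A1ModTau) ∈ Cobar.extGrade A1ModTau grade 0 := by
  refine ⟨1, Submodule.subset_span ⟨0, 0, fun i => i.elim0, ?_, ?_⟩, map_one cls⟩
  · rfl
  · exact (by simp [TensorAlgebra.tprod_apply] : (1 : CobarCx) = tprod (ZMod 2) _ 0 0)

instance : SetLike.GradedMonoid (Cobar.extGrade A1ModTau grade) where
  one_mem := extGrade_one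
  mul_mem _ _ _ _ := extGrade_mul

/-- The weights of `τ₀`, `τ₁`, `ξ₁`. -/
abbrev weights : Fin 3 → ℤ × ℤ := ![(1, 0), (3, 1), (2, 1)]

/-- The internal degree of a letter. -/
def letterDeg : Fin 7 → ℤ × ℤ := ![(1, 0), (2, 1), (3, 1), (3, 1), (4, 1), (5, 2), (6, 2)]

lemma weight_expo (i : Fin 7) : Finsupp.weight weights (expo i.succ) = letterDeg i := by
  rw [Finsupp.weight_apply, Finsupp.sum_fintype _ _ (by simp)]
  change ∑ k, expVec i.succ k • weights k = _
  revert i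
  decide

lemma letter_mem (i : Fin 7) :
    letter i ∈ Cobar.complexGrade A1ModTau grade 1 (letterDeg i) := by
  refine Submodule.subset_span ⟨fun _ => letterDeg i, fun _ => augBasis i, fun _ => ?_, ?_, ?_⟩
  · rw [augBasis_apply]
    exact ⟨_, isWeightedHomogeneous_monomial _ _ _ (weight_expo i), rfl⟩
  · simp
  · simp [TensorAlgebra.tprod_apply, letter]

lemma bCocycle_mem : bCocycle ∈ Cobar.complexGrade A1ModTau grade 2 (6, 2) := by
  have h : ∀ i j, letterDeg i + letterDeg j = (6, 2) →
      letter i * letter j ∈ Cobar.complexGrade A1ModTau grade 2 (6, 2) := by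
    intro i j hij
    have := complexGrade_mul grade (letter_mem i) (letter_mem j)
    rwa [hij, one_add_one_eq_two] at this
  exact add_mem (add_mem (h 2 2 (by decide)) (h 1 4 (by decide))) (h 5 0 (by decide))

/-- The tridegrees of the generators. -/
abbrev extWeights : Fin 3 → ℤ × ℕ × ℤ := ![(0, 1, 0), (1, 1, 1), (4, 2, 2)]

lemma cls_cocycleGen_mem (i : Fin 3) :
    cls (cocycleGen i) ∈ Cobar.extGrade A1ModTau grade (extWeights i) := by
  refine ⟨cocycleGen i, ?_, rfl⟩
  fin_cases i
  exacts [letter_mem 0, letter_mem 1, bCocycle_mem]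

lemma extEquiv_mem {n : ℤ × ℕ × ℤ} {r : ExtRing} (hr : r ∈ ExtRing.grade n) :
    extEquiv r ∈ Cobar.extGrade A1ModTau grade n := by
  obtain ⟨p, hp, rfl⟩ := hr
  have hp : p.IsWeightedHomogeneous extWeights n := hp
  change extEquiv (Ideal.Quotient.mkₐ (ZMod 2) relIdeal p) ∈ _
  rw [p.as_sum, map_sum, map_sum]
  refine sum_mem fun m hm => ?_
  have hw := hp (mem_support_iff.1 hm)
  rw [monomial_eq, Finsupp.prod_fintype _ _ (by simp), ← algebraMap_eq, ← Algebra.smul_def,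
    map_smul, map_smul, map_prod, Fin.prod_univ_three]
  refine Submodule.smul_mem _ _ ?_
  simp only [map_mul, map_pow, extEquiv_mk_X]
  rw [← hw, Finsupp.weight_apply, Finsupp.sum_fintype _ _ (by simp), Fin.sum_univ_three]
  exact SetLike.mul_mem_graded (SetLike.mul_mem_graded
    (SetLike.pow_mem_graded _ (cls_cocycleGen_mem 0))
    (SetLike.pow_mem_graded _ (cls_cocycleGen_mem 1)))
    (SetLike.pow_mem_graded _ (cls_cocycleGen_mem 2))

/-- The tridegrees of `h₀`, `h₁`, `v` in the polynomial model. -/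
abbrev modelWeights : Fin 3 → ℤ × ℕ × ℤ := ![(0, 1, 0), (1, 1, 1), (2, 1, 1)]

lemma gen_isWeightedHomogeneous (i : Fin 7) :
    (gen i).IsWeightedHomogeneous modelWeights ((letterDeg i).1 - 1, 1, (letterDeg i).2) := by
  have h := isWeightedHomogeneous_X (ZMod 2) modelWeights
  fin_cases i
  exacts [h 0, h 1, h 2, isWeightedHomogeneous_zero _ _ _, isWeightedHomogeneous_zero _ _ _,
    isWeightedHomogeneous_zero _ _ _, isWeightedHomogeneous_zero _ _ _]

lemma toModel_ι_isWeightedHomogeneous {δ : ℤ × ℤ} {a : Cobar.Aug A1ModTau}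
    (ha : (a : A1ModTau) ∈ grade δ) :
    (toModel (ι (ZMod 2) a)).IsWeightedHomogeneous modelWeights (δ.1 - 1, 1, δ.2) := by
  rw [← augBasis.sum_repr a, map_sum, map_sum]
  refine IsWeightedHomogeneous.sum _ _ _ fun i _ => ?_
  rw [map_smul, map_smul, ← letter, toModel_letter, ← Module.Basis.coord_apply, augBasis_coord]
  obtain ⟨p, hp, hpa⟩ := ha
  have hp : p.IsWeightedHomogeneous weights δ := hp
  have hpa : mk p = a := hpa
  rw [← hpa, coord_mk]
  by_cases h : coeff (expo i.succ) p = 0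
  · rw [h, zero_smul]
    exact isWeightedHomogeneous_zero _ _ _
  · have hδ := hp h
    rw [weight_expo] at hδ
    rw [← hδ, smul_eq_C_mul]
    exact (gen_isWeightedHomogeneous i).C_mul _

/-- The comparison map turns topological degree `s + f` in filtration `f` into stem `s`. -/
lemma toModel_isWeightedHomogeneous {n : ℤ × ℕ × ℤ} {x : CobarCx}
    (hx : x ∈ Cobar.complexGrade A1ModTau grade n.2.1 (n.1 + n.2.1, n.2.2)) :
    (toModel x).IsWeightedHomogeneous modelWeights n := by
  have hle : Cobar.complexGrade A1ModTau grade n.2.1 (n.1 + n.2.1, n.2.2) ≤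
      (weightedHomogeneousSubmodule (ZMod 2) modelWeights n).comap toModel.toLinearMap := by
    refine Submodule.span_le.2 ?_
    rintro _ ⟨δ, a, ha, hδ, rfl⟩
    change (toModel _).IsWeightedHomogeneous modelWeights n
    rw [TensorAlgebra.tprod_apply, map_list_prod, List.map_ofFn, List.prod_ofFn]
    have h := IsWeightedHomogeneous.prod Finset.univ
      (fun i => toModel (ι (ZMod 2) (a i))) (fun i => ((δ i).1 - 1, 1, (δ i).2))
      (w := modelWeights) fun i _ => toModel_ι_isWeightedHomogeneous (ha i)
    have h1 := congrArg Prod.fst hδ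
    have h2 := congrArg Prod.snd hδ
    rw [Prod.fst_sum] at h1
    rw [Prod.snd_sum] at h2
    have hn : ∑ i, ((δ i).1 - 1, 1, (δ i).2) = n := by
      refine Prod.ext ?_ (Prod.ext ?_ ?_)
      · rw [Prod.fst_sum]
        simp [h1]
      · rw [Prod.snd_sum, Prod.fst_sum]
        simp
      · rw [Prod.snd_sum, Prod.snd_sum]
        simp [h2]
    rw [hn] at h
    exact h
  exact hle hx

lemma sqMap_isWeightedHomogeneous {n : ℤ × ℕ × ℤ} {p : Model}
    (hp : p.IsWeightedHomogeneous extWeights n) :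
    (sqMap p).IsWeightedHomogeneous modelWeights n := by
  have h := isWeightedHomogeneous_X (ZMod 2) modelWeights
  rw [p.as_sum, map_sum]
  refine IsWeightedHomogeneous.sum _ _ _ fun m hm => ?_
  rw [← hp (mem_support_iff.1 hm), monomial_eq, Finsupp.prod_fintype _ _ (by simp), map_mul,
    map_prod, Fin.prod_univ_three, Finsupp.weight_apply, Finsupp.sum_fintype _ _ (by simp),
    Fin.sum_univ_three]
  simp only [map_pow, sqMap, aeval_X, algHom_C, algebraMap_eq]
  exact ((((h 0).pow _).mul ((h 1).pow _)).mul (((h 2).pow 2).pow _)).C_mul _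

attribute [local instance] MvPolynomial.weightedGradedAlgebra in
lemma weightedHomogeneousComponent_mem_relIdeal (n : ℤ × ℕ × ℤ) {p : Model}
    (hp : p ∈ relIdeal) : weightedHomogeneousComponent modelWeights n p ∈ relIdeal := by
  refine weightedHomogeneousComponent_mem_of_mem (ZMod 2) modelWeights ?_ hp n
  refine Ideal.homogeneous_span _ _ ?_
  rintro _ rfl
  exact ⟨_, (isWeightedHomogeneous_X (ZMod 2) modelWeights 0).mul (isWeightedHomogeneous_X _ _ 1)⟩

lemma extEquiv_symm_mem {n : ℤ × ℕ × ℤ} {r : ExtRing}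
    (hr : extEquiv r ∈ Cobar.extGrade A1ModTau grade n) : r ∈ ExtRing.grade n := by
  obtain ⟨x, hx, hxr⟩ := hr
  have hxr : cls x = extEquiv r := hxr
  have hx : (toModel x).IsWeightedHomogeneous modelWeights n := toModel_isWeightedHomogeneous hx
  obtain ⟨p, rfl⟩ := Ideal.Quotient.mkₐ_surjective (ZMod 2) relIdeal r
  have h := congrArg extToRing hxr
  rw [extToRing_cls, extToRing_extEquiv, sqRing_mk] at h
  -- the component of `p` of degree `n` has the same image
  have hmem := weightedHomogeneousComponent_mem_relIdeal n (Ideal.Quotient.eq.1 h)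
  rw [map_sub, weightedHomogeneousComponent_eq_self hx] at hmem
  have hcomp : weightedHomogeneousComponent modelWeights n (sqMap p) =
      sqMap (weightedHomogeneousComponent extWeights n p) :=
    weightedHomogeneousComponent_map' extWeights modelWeights sqMap.toLinearMap
      Function.injective_id (fun _ _ => sqMap_isWeightedHomogeneous) n p
  rw [hcomp] at hmem
  refine ⟨weightedHomogeneousComponent extWeights n p,
    weightedHomogeneousComponent_isWeightedHomogeneous n p, ?_⟩
  apply sqRing_injective
  exact (Ideal.Quotient.eq.2 hmem).symm.trans h

end A1ModTau
end

theorem proposition3p2 :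
    ∃ φ : ExtRing ≃ₐ[ZMod 2] Cobar.Ext A1ModTau,
      ∀ n : ℤ × ℕ × ℤ,
        (ExtRing.grade n).map φ.toLinearMap = Cobar.extGrade A1ModTau A1ModTau.grade n := by
  refine ⟨A1ModTau.extEquiv, fun n => le_antisymm ?_ fun x hx => ?_⟩
  · rintro _ ⟨r, hr, rfl⟩
    exact A1ModTau.extEquiv_mem hr
  · obtain ⟨r, rfl⟩ := A1ModTau.extEquiv.surjective x
    exact ⟨r, A1ModTau.extEquiv_symm_mem hx, rfl⟩
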